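/- Let $0\le k\le n$ and let $M$ be a matroid of rank $k$ on the ground set $[n]=\{1,\dots,n\}$. For $B\subseteq[n]$ let $e_B=\sum_{i\in B}e_i\in\mathbb{R}^n$, and let $\Gamma_M=\operatorname{conv}\{e_B : B \text{ a basis of } M\}\subset\mathbb{R}^n$ be the matroid polytope of $M$. A matroid on $[n]$ is a positroid if, for some $r$ and some real $r\times n$ matrix $A$ of rank $r$ all of whose maximal minors (columns taken in increasing order) are nonnegative, its bases are exactly the $r$-element sets $I\subseteq[n]$ for which the minor of $A$ on the columns $I$ is nonzero. A positroid polytope is a set of the form $\Gamma_N$ with $N$ a positroid on $[n]$. Faces of a polytope are the sets of maximizers of linear functionals on it, so the polytope is a face of itself. Then $\Gamma_M$ is a positroid polytope if and only if $M$ is a positroid, and $\Gamma_M$ is a positroid polytope if and only if all two-dimensional faces of $\Gamma_M$ are positroid polytopes. Moreover, if $M$ is not a positroid, then $\Gamma_M$ has a two-dimensional face whose vertices are exactly $e_{S\cup\{a,b\}}$, $e_{S\cup\{a,d\}}$, $e_{S\cup\{b,c\}}$, $e_{S\cup\{c,d\}}$ for some $1\le a<b<c<d\le n$ and some $S\subseteq[n]$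 with $|S|=k-2$ and $S\cap\{a,b,c,d\}=\emptyset$. -/

import Mathlib

namespace PositroidChar

/-- The indicator vector `e_B = ∑_{i ∈ B} e_i` in `ℝⁿ`. -/
noncomputable def indVec {n : ℕ} (B : Set (Fin n)) : Fin n → ℝ :=
  B.indicator 1

/-- The (basis) matroid polytope `Γ_M`: the convex hull of the indicator vectors of the bases. -/
def matroidPolytope {n : ℕ} (M : Matroid (Fin n)) : Set (Fin n → ℝ) :=
  convexHull ℝ (indVec '' {B | M.IsBase B})

/-- The Plücker coordinate `p_I(A)`: the `k × k` minor of the `k × n` matrix `A` on the columns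
in `I`, taken in increasing order. -/
noncomputable def plucker {n k : ℕ} (A : Matrix (Fin k) (Fin n) ℝ) (I : Finset (Fin n))
    (hI : I.card = k) : ℝ :=
  (A.submatrix id (I.orderEmbOfFin hI)).det

/-- `M` is a positroid on `[n]`: its bases are the `k`-subsets `I` with `p_I(A) ≠ 0`, for some
real `k × n` matrix `A` all of whose maximal minors are nonnegative. (As a matroid has a basis,
some maximal minor of `A` is nonzero, so `A` has rank `k`.) -/
def IsPositroid {n : ℕ} (M : Matroid (Fin n)) : Prop :=
  M.E = Set.univ ∧
  ∃ (k : ℕ) (A : Matrix (Fin k) (Fin n) ℝ),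
    (∀ (I : Finset (Fin n)) (hI : I.card = k), 0 ≤ plucker A I hI) ∧
    ∀ I : Finset (Fin n), M.IsBase (I : Set (Fin n)) ↔ ∃ hI : I.card = k, plucker A I hI ≠ 0

/-- A subset of `ℝⁿ` is a positroid polytope if it is the matroid polytope of a positroid. -/
def IsPositroidPolytope {n : ℕ} (P : Set (Fin n → ℝ)) : Prop :=
  ∃ N : Matroid (Fin n), IsPositroid N ∧ P = matroidPolytope N

/-- `F` is a two-dimensional face of the polytope `P`: it is the set of maximizers on `P` of some
linear functional (possibly zero, so that `P` is a face of itself), and its affine span has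
dimension two. -/
def IsTwoFace {n : ℕ} (P F : Set (Fin n → ℝ)) : Prop :=
  F.Nonempty ∧ IsExposed ℝ P F ∧ Module.finrank ℝ (vectorSpan ℝ F) = 2

end PositroidChar

namespace PositroidChar

open Finset

/-! ### Minors on ordered and unordered families of columns -/

/-! The core is a combinatorial description of positroids: a matroid is a positroid exactly when it
satisfies `PosThreeTerm`, that is, whenever for a < b < c < d both members of one pair of opposite
sides, {S+ab, S+cd} or {S+ad, S+bc}, are bases, both diagonals S+ac and S+bd are bases. Necessity
(`IsPositroid.posThreeTerm`) is the three-term Plücker relation p_ac p_bd = p_ab p_cd + p_ad p_bc: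
with nonnegative minors nothing cancels on the right.

Sufficiency (`PosThreeTerm.isPositroid`) goes through tropical geometry. The condition first implies
that sorting two bases yields two bases (`PosThreeTerm.isBase_of_sortPair`); this comes from the
noncrossing structure of hyperplanes in `isBase_of_between`. Hence the weight that is 0 on bases and
infinite elsewhere satisfies an exchange inequality and a sorting inequality. Tropical column
operations between adjacent columns (`bridge`) preserve both inequalities and the zero set, and
enough of them make the weight finite on all k-sets (`exists_full_support`). Together the two
inequalities are the positive tropical three-term relation (`three_term_of_ineq`). Such a finite
weight w is realized by matrices A(t) whose minors are positive and of order t^w (`exists_family`):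
columns are added one at a time, and the three-term relation, solved without subtraction, controls
every new minor. After normalization, a limit as t tends to 0 keeps exactly the minors with w = 0
(`exists_limit_matrix`).

For the polytopes: a 0/1 polytope determines its vertices, so the polytope determines the matroid.
Every face of a matroid polytope is the polytope of the bases maximizing a functional, and
`PosThreeTerm` passes to this face because the indicator vectors of opposite sides and of diagonals
have equal sums. Conversely, if `PosThreeTerm` fails, symmetric exchange makes all four sides bases
while some diagonal is not, and an explicit functional exposes the square on the four sides
(`square_isTwoFace`). The matroid of that square violates `PosThreeTerm`, so the square is not a
positroid polytope. -/

/-- The determinant of the columns `g 0, g 1, …` of `A`, in this order. -/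
noncomputable def colDet {n k : ℕ} (A : Matrix (Fin k) (Fin n) ℝ) (g : Fin k → Fin n) : ℝ :=
  (A.submatrix id g).det

/-- The maximal minor of `A` on the columns in `I`, zero if `I` has the wrong cardinality. -/
noncomputable def minor {n k : ℕ} (A : Matrix (Fin k) (Fin n) ℝ) (I : Finset (Fin n)) : ℝ :=
  if h : I.card = k then plucker A I h else 0

theorem minor_eq {n k : ℕ} (A : Matrix (Fin k) (Fin n) ℝ) {I : Finset (Fin n)}
    (h : I.card = k) : minor A I = colDet A (I.orderEmbOfFin h) := by
  simp [minor, h, plucker, colDet]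

theorem colDet_eq_zero {n k : ℕ} (A : Matrix (Fin k) (Fin n) ℝ) {g : Fin k → Fin n}
    (hg : ¬ Function.Injective g) : colDet A g = 0 := by
  simp only [Function.Injective, not_forall] at hg
  obtain ⟨i, j, hij, hne⟩ := hg
  exact Matrix.det_zero_of_column_eq hne (fun r => by simp [hij])

/-- The sign is that of the permutation sorting `g`. Since it is the same for every matrix, it can
be computed from one matrix whose minors are known, namely `vander`. -/
theorem exists_sign_colDet {n k : ℕ} {g : Fin k → Fin n} (hg : Function.Injective g)
    {I : Finset (Fin n)} (hI : univ.image g = I) :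
    ∃ ε : ℝ, (ε = 1 ∨ ε = -1) ∧
      ∀ A : Matrix (Fin k) (Fin n) ℝ, colDet A g = ε * minor A I := by
  have hc : I.card = k := by rw [← hI, card_image_of_injective _ hg]; simp
  have hmem : ∀ i, g i ∈ I := fun i => hI ▸ mem_image_of_mem g (mem_univ i)
  let f : Fin k → Fin k := fun i => (I.orderIsoOfFin hc).symm ⟨g i, hmem i⟩
  have hf : ∀ i, I.orderEmbOfFin hc (f i) = g i := by
    intro i
    simp only [f, ← coe_orderIsoOfFin_apply, OrderIso.apply_symm_apply]
  have hfi : Function.Injective f := fun a b h => hg (by rw [← hf a, ← hf b, h])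
  let σ : Equiv.Perm (Fin k) := Equiv.ofBijective f (Finite.injective_iff_bijective.mp hfi)
  refine ⟨((Equiv.Perm.sign σ : ℤ) : ℝ), ?_, fun A => ?_⟩
  · rcases Int.units_eq_one_or (Equiv.Perm.sign σ) with h | h <;> simp [h]
  · rw [minor_eq A hc, colDet, colDet, ← Matrix.det_permute']
    congr 1
    ext i j
    simp [σ, hf]

theorem abs_colDet {n k : ℕ} {g : Fin k → Fin n} (hg : Function.Injective g)
    {I : Finset (Fin n)} (hI : univ.image g = I) (A : Matrix (Fin k) (Fin n) ℝ) :
    |colDet A g| = |minor A I| := by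
  obtain ⟨ε, hε, h⟩ := exists_sign_colDet hg hI
  rcases hε with rfl | rfl <;> simp [h]

/-- The matrix with entries `j ^ r`; all its maximal minors are positive. -/
noncomputable def vander (k n : ℕ) : Matrix (Fin k) (Fin n) ℝ :=
  Matrix.of fun r j => (j : ℝ) ^ (r : ℕ)

theorem colDet_vander {n k : ℕ} (g : Fin k → Fin n) :
    colDet (vander k n) g = ∏ i, ∏ j ∈ Ioi i, ((g j : ℝ) - (g i : ℝ)) := by
  rw [← Matrix.det_vandermonde (fun i => ((g i : ℕ) : ℝ)), colDet, ← Matrix.det_transpose]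
  congr 1

theorem minor_vander_pos {n k : ℕ} {I : Finset (Fin n)} (h : I.card = k) :
    0 < minor (vander k n) I := by
  rw [minor_eq _ h, colDet_vander]
  refine prod_pos fun i _ => prod_pos fun j hj => ?_
  have : I.orderEmbOfFin h i < I.orderEmbOfFin h j := by simpa using hj
  have h2 : ((I.orderEmbOfFin h i : ℕ)) < (I.orderEmbOfFin h j : ℕ) := this
  have h3 : ((I.orderEmbOfFin h i : ℕ) : ℝ) < (I.orderEmbOfFin h j : ℕ) := by exact_mod_cast h2
  linarith

/-! ### The three-term relation -/

/-- The determinant with rows `x`, `y`, and the rows of `U`. -/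
noncomputable def twoDet {m : ℕ} (U : Fin m → Fin (m + 2) → ℝ) (x y : Fin (m + 2) → ℝ) : ℝ :=
  Matrix.det (Matrix.of (Fin.cons x (Fin.cons y U : Fin (m + 1) → Fin (m + 2) → ℝ) :
    Fin (m + 2) → Fin (m + 2) → ℝ))

theorem twoDet_swap {m : ℕ} (U : Fin m → Fin (m + 2) → ℝ) (x y : Fin (m + 2) → ℝ) :
    twoDet U x y = - twoDet U y x := by
  have h := Matrix.det_permute (Equiv.swap (0 : Fin (m + 2)) 1)
    (Matrix.of (Fin.cons x (Fin.cons y U : Fin (m + 1) → Fin (m + 2) → ℝ) :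
    Fin (m + 2) → Fin (m + 2) → ℝ))
  rw [Equiv.Perm.sign_swap (by simp)] at h
  have h2 : twoDet U y x = _ := (congrArg Matrix.det ?_).trans h
  · rw [h2]; simp [twoDet]
  · ext i j
    refine Fin.cases ?_ (fun i => Fin.cases ?_ (fun i => ?_) i) i
    · simp
    · have : (Fin.succ 0 : Fin (m + 2)) = 1 := rfl
      simp [this]
    · have h1 : (i.succ.succ : Fin (m + 2)) ≠ 0 := Fin.succ_ne_zero _
      have h2 : (i.succ.succ : Fin (m + 2)) ≠ 1 := by
        intro h
        have : (i.succ.succ : Fin (m + 2)) = Fin.succ 0 := h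
        exact Fin.succ_ne_zero _ (Fin.succ_injective _ this)
      simp [Equiv.swap_apply_of_ne_of_ne h1 h2]

/-- `twoDet U x` as a linear map. -/
noncomputable def twoDetLin {m : ℕ} (U : Fin m → Fin (m + 2) → ℝ) (x : Fin (m + 2) → ℝ) :
    (Fin (m + 2) → ℝ) →ₗ[ℝ] ℝ :=
  (Matrix.detRowAlternating (n := Fin (m + 2)) (R := ℝ)).toMultilinearMap.toLinearMap
    (Fin.cons x (Fin.cons 0 U : Fin (m + 1) → Fin (m + 2) → ℝ)) 1

theorem twoDetLin_apply {m : ℕ} (U : Fin m → Fin (m + 2) → ℝ) (x y : Fin (m + 2) → ℝ) :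
    twoDetLin U x y = twoDet U x y := by
  simp only [twoDetLin, MultilinearMap.toLinearMap_apply, twoDet]
  have : Function.update (Fin.cons x (Fin.cons 0 U : Fin (m + 1) → Fin (m + 2) → ℝ) :
      Fin (m + 2) → Fin (m + 2) → ℝ) 1 y = Fin.cons x (Fin.cons y U) := by
    have h : (1 : Fin (m + 2)) = Fin.succ 0 := rfl
    rw [h, ← Fin.cons_update, Fin.update_cons_zero]
  rw [this]
  rfl

theorem twoDet_row {m : ℕ} (U : Fin m → Fin (m + 2) → ℝ) (x : Fin (m + 2) → ℝ) (i : Fin m) :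
    twoDet U x (U i) = 0 := by
  refine Matrix.det_zero_of_row_eq (i := Fin.succ 0) (j := i.succ.succ) ?_ ?_
  · exact fun h => Fin.succ_ne_zero _ (Fin.succ_injective _ h).symm
  · rfl

/-- When c, d and the rows of U form a basis, b is a combination of them; its U-part contributes
nothing, and after substituting for b both sides are the same polynomial in the remaining
determinants. -/
theorem twoDet_plucker_of_ne {m : ℕ} (U : Fin m → Fin (m + 2) → ℝ) (a b c d : Fin (m + 2) → ℝ)
    (h : twoDet U c d ≠ 0) :
    twoDet U a c * twoDet U b d = twoDet U a b * twoDet U c d + twoDet U a d * twoDet U b c := by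
  set X : Matrix (Fin (m + 2)) (Fin (m + 2)) ℝ :=
    Matrix.of (Fin.cons c (Fin.cons d U : Fin (m + 1) → Fin (m + 2) → ℝ)) with hX
  have hu : IsUnit X.det := isUnit_iff_ne_zero.mpr h
  set q := Matrix.vecMul b X⁻¹ with hq
  have hb : Matrix.vecMul q X = b := by
    rw [hq, Matrix.vecMul_vecMul, Matrix.nonsing_inv_mul _ hu, Matrix.vecMul_one]
  have hb' : b = q 0 • c + (q 1 • d + ∑ i : Fin m, q i.succ.succ • U i) := by
    rw [← hb, Matrix.vecMul_eq_sum, Fin.sum_univ_succ, Fin.sum_univ_succ]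
    rfl
  have key : ∀ x, twoDet U x b = q 0 * twoDet U x c + q 1 * twoDet U x d := by
    intro x
    rw [← twoDetLin_apply, hb', map_add, map_add, map_sum, map_smul, map_smul]
    simp only [map_smul, twoDetLin_apply, twoDet_row, smul_eq_mul, mul_zero, sum_const_zero,
      add_zero]
  have hself : ∀ x, twoDet U x x = 0 := fun x => by
    have := twoDet_swap U x x
    linarith
  rw [twoDet_swap U b d, twoDet_swap U b c, key, key, key, hself, hself, twoDet_swap U d c]
  ring

/-- Relabelling the four vectors permutes the terms up to sign, so the previous case applies as soon
as one of the determinants cd, ab, ad, ac is nonzero. If all four vanish, every term is zero. -/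
theorem twoDet_plucker {m : ℕ} (U : Fin m → Fin (m + 2) → ℝ) (a b c d : Fin (m + 2) → ℝ) :
    twoDet U a c * twoDet U b d = twoDet U a b * twoDet U c d + twoDet U a d * twoDet U b c := by
  by_cases h1 : twoDet U c d = 0
  swap
  · exact twoDet_plucker_of_ne U a b c d h1
  by_cases h2 : twoDet U a b = 0
  swap
  · have := twoDet_plucker_of_ne U c d a b h2
    rw [twoDet_swap U c a, twoDet_swap U d b, twoDet_swap U c b, twoDet_swap U d a] at this
    linarith
  by_cases h3 : twoDet U a d = 0
  · by_cases h4 : twoDet U a c = 0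
    · simp [h2, h3, h4]
    · have := twoDet_plucker_of_ne U b d a c h4
      rw [twoDet_swap U b a, twoDet_swap U d c, twoDet_swap U d a] at this
      rw [h1, h2, h3] at this ⊢
      linarith
  · have := twoDet_plucker_of_ne U b c a d h3
    rw [twoDet_swap U b a, twoDet_swap U c a] at this
    linarith

theorem colDet_cons_cons {n m : ℕ} (A : Matrix (Fin (m + 2)) (Fin n) ℝ) (u : Fin m → Fin n)
    (x y : Fin n) :
    colDet A (Fin.cons x (Fin.cons y u : Fin (m + 1) → Fin n)) =
      twoDet (fun i => A.transpose (u i)) (A.transpose x) (A.transpose y) := by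
  rw [colDet, ← Matrix.det_transpose, twoDet]
  congr 1
  ext i j
  refine Fin.cases ?_ (fun i => Fin.cases ?_ (fun i => ?_) i) i <;> simp

/-- Only signs remain after `twoDet_plucker`. Evaluating on `vander` shows that moving the columns x
< y into place among those of S costs a sign that factors into one part depending on S, one on x and
one on y. All three products therefore carry the same total sign, and the relation holds for sorted
minors without extra signs. -/
theorem minor_three_term {n k : ℕ} (A : Matrix (Fin k) (Fin n) ℝ) {S : Finset (Fin n)}
    (hS : S.card + 2 = k) {a b c d : Fin n} (hab : a < b) (hbc : b < c) (hcd : c < d)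
    (ha : a ∉ S) (hb : b ∉ S) (hc : c ∉ S) (hd : d ∉ S) :
    minor A (S ∪ {a, c}) * minor A (S ∪ {b, d}) =
      minor A (S ∪ {a, b}) * minor A (S ∪ {c, d}) +
      minor A (S ∪ {a, d}) * minor A (S ∪ {b, c}) := by
  obtain ⟨m, hm⟩ : ∃ m, m = S.card := ⟨_, rfl⟩
  obtain rfl : k = m + 2 := by omega
  let u : Fin m → Fin n := S.orderEmbOfFin hm.symm
  have hu : Function.Injective u := (S.orderEmbOfFin hm.symm).injective
  have hur : ∀ i, u i ∈ S := fun i => S.orderEmbOfFin_mem hm.symm i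
  have huim : univ.image u = S := by
    ext x
    have := Set.ext_iff.mp (S.range_orderEmbOfFin hm.symm) x
    simp only [Set.mem_range, mem_coe] at this
    simp only [mem_image, mem_univ, true_and, u, this]
  let e : Fin n → ℝ := fun x => ∏ i, ((u i : ℝ) - (x : ℝ))
  let V : ℝ := ∏ i, ∏ j ∈ Ioi i, ((u j : ℝ) - (u i : ℝ))
  let s : ℝ → ℝ := fun x => (SignType.sign x : ℝ)
  have hsmul : ∀ x y, s (x * y) = s x * s y := fun x y => by simp [s, sign_mul]
  have key : ∀ x y, x < y → x ∉ S → y ∉ S → minor A (S ∪ {x, y}) =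
      s V * s (e x) * s (e y) *
        twoDet (fun i => A.transpose (u i)) (A.transpose x) (A.transpose y) := by
    intro x y hxy hx hy
    let g : Fin (m + 2) → Fin n := Fin.cons x (Fin.cons y u : Fin (m + 1) → Fin n)
    have hg : Function.Injective g := by
      refine Fin.cons_injective_iff.mpr ⟨?_, Fin.cons_injective_iff.mpr ⟨?_, hu⟩⟩
      · rintro ⟨i, hi⟩
        revert hi
        refine Fin.cases (fun h => ?_) (fun i h => ?_) i
        · exact hxy.ne' h
        · exact hx (h ▸ hur i)
      · rintro ⟨i, hi⟩
        exact hy (hi ▸ hur i)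
    have him : univ.image g = S ∪ {x, y} := by
      ext z
      simp only [mem_image, mem_univ, true_and, Fin.exists_fin_succ, g, Fin.cons_zero,
        Fin.cons_succ, mem_union, mem_insert, mem_singleton]
      rw [← huim]
      simp only [mem_image, mem_univ, true_and]
      grind
    obtain ⟨ε, hε, h⟩ := exists_sign_colDet hg him
    have hcard : (S ∪ {x, y}).card = m + 2 := by
      rw [← him, card_image_of_injective _ hg]; simp
    have hW := h (vander (m + 2) n)
    have hpos := minor_vander_pos hcard
    have hD : colDet (vander (m + 2) n) g = (((y : ℝ) - x) * e x) * (e y * V) := by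
      rw [colDet_vander]
      simp only [Fin.prod_univ_succ (n := m + 1), Fin.prod_univ_succ (n := m), Fin.prod_Ioi_zero,
        Fin.prod_Ioi_succ, g, Fin.cons_zero, Fin.cons_succ]
      rfl
    have hyx : (0 : ℝ) < (y : ℝ) - x := by
      have : ((x : ℕ) : ℝ) < (y : ℕ) := by exact_mod_cast hxy
      linarith
    -- The sorted Vandermonde minor is positive, so ε is the sign of the unsorted one, whose product
    -- formula splits as (y - x) · e x · e y · V.
    have hεs : ε = s V * s (e x) * s (e y) := by
      have h1 : s (colDet (vander (m + 2) n) g) = ε := by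
        rw [hW, hsmul]
        have : s (minor (vander (m + 2) n) (S ∪ {x, y})) = 1 := by
          simp only [s, sign_pos hpos]; simp
        rw [this]
        rcases hε with rfl | rfl <;> simp [s]
      rw [← h1, hD]
      simp only [hsmul]
      have : s ((y : ℝ) - x) = 1 := by simp only [s, sign_pos hyx]; simp
      rw [this]; ring
    rw [← hεs, ← colDet_cons_cons, show colDet A _ = _ from h A, ← mul_assoc]
    rcases hε with rfl | rfl <;> simp
  rw [key a c (hab.trans hbc) ha hc, key b d (hbc.trans hcd) hb hd, key a b hab ha hb,
    key c d hcd hc hd, key a d (hab.trans (hbc.trans hcd)) ha hd, key b c hbc hb hc]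
  have := twoDet_plucker (fun i => A.transpose (u i)) (A.transpose a) (A.transpose b)
    (A.transpose c) (A.transpose d)
  linear_combination (s V * s V * s (e a) * s (e b) * s (e c) * s (e d)) * this

end PositroidChar

namespace PositroidChar

open Finset

/-! ### Exchange and sorting inequalities -/

/-- The set `I - x + y`. -/
def exch {n : ℕ} (I : Finset (Fin n)) (x y : Fin n) : Finset (Fin n) := insert y (I.erase x)

theorem mem_exch {n : ℕ} {I : Finset (Fin n)} {x y z : Fin n} :
    z ∈ exch I x y ↔ z = y ∨ (z ≠ x ∧ z ∈ I) := by
  simp [exch]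

theorem card_exch {n : ℕ} {I : Finset (Fin n)} {x y : Fin n} (hx : x ∈ I) (hy : y ∉ I) :
    (exch I x y).card = I.card := by
  rw [exch, card_insert_of_notMem (fun h => hy (mem_of_mem_erase h)), card_erase_of_mem hx]
  have := card_pos.mpr ⟨x, hx⟩
  omega

/-- The number of elements of `I` that are less than `m`. -/
def cnt {n : ℕ} (I : Finset (Fin n)) (m : ℕ) : ℕ := (I.filter fun x : Fin n => (x : ℕ) < m).card

theorem cnt_exch {n : ℕ} {I : Finset (Fin n)} {x y : Fin n} (hx : x ∈ I) (hy : y ∉ I) (m : ℕ) :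
    cnt (exch I x y) m + (if (x : ℕ) < m then 1 else 0) =
      cnt I m + (if (y : ℕ) < m then 1 else 0) := by
  have h1 : cnt (exch I x y) m =
      cnt (I.erase x) m + (if (y : ℕ) < m then 1 else 0) := by
    rw [cnt, exch, filter_insert]
    split_ifs with h
    · rw [card_insert_of_notMem (by simp [hy])]; rfl
    · rfl
  have h2 : cnt I m = cnt (I.erase x) m + (if (x : ℕ) < m then 1 else 0) := by
    rw [cnt]
    nth_rw 1 [← insert_erase hx]
    rw [filter_insert]
    split_ifs with h
    · rw [card_insert_of_notMem (by simp)]; rfl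
    · rfl
  omega

theorem cnt_succ {n : ℕ} (I : Finset (Fin n)) (x : Fin n) :
    cnt I ((x : ℕ) + 1) = cnt I x + (if x ∈ I then 1 else 0) := by
  have : I.filter (fun z : Fin n => (z : ℕ) < x + 1) =
      I.filter (fun z : Fin n => (z : ℕ) < x) ∪ (if x ∈ I then {x} else ∅) := by
    ext z
    have hz : (z : ℕ) = x ↔ z = x := Fin.ext_iff.symm
    split_ifs with h <;> grind
  rw [cnt, cnt, this, card_union_of_disjoint]
  · split_ifs <;> simp
  · split_ifs <;> simp

/-- `K` and `L` are obtained from `I` and `J` by sorting the multiset union of `I` and `J` and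
distributing its elements alternately. -/
def SortPair {n : ℕ} (I J K L : Finset (Fin n)) : Prop :=
  ∀ m, cnt K m + cnt L m = cnt I m + cnt J m ∧ cnt L m ≤ cnt K m ∧ cnt K m ≤ cnt L m + 1

theorem SortPair.symm {n : ℕ} {I J K L : Finset (Fin n)} (h : SortPair I J K L) :
    SortPair J I K L := fun m => by
  have := h m
  omega

/-- The exchange property of a valuated matroid (in the minimum convention). -/
def ExchangeIneq {n : ℕ} (k : ℕ) (w : Finset (Fin n) → ℕ∞) : Prop :=
  ∀ I J : Finset (Fin n), I.card = k → J.card = k → ∀ x ∈ I, x ∉ J →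
    ∃ y ∈ J, y ∉ I ∧ w (exch I x y) + w (exch J y x) ≤ w I + w J

/-- Sorting a pair of sets does not increase the total weight. -/
def SortIneq {n : ℕ} (k : ℕ) (w : Finset (Fin n) → ℕ∞) : Prop :=
  ∀ I J K L : Finset (Fin n), I.card = k → J.card = k → K.card = k → L.card = k →
    SortPair I J K L → w K + w L ≤ w I + w J

/-! ### Bridges -/

/-- The tropical analogue of adding a multiple of column `i` to column `j`. -/
noncomputable def bridge {n : ℕ} (i j : Fin n) (w : Finset (Fin n) → ℕ∞) (I : Finset (Fin n)) :
    ℕ∞ :=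
  if j ∈ I ∧ i ∉ I then min (w I) (w (exch I j i) + 1) else w I

theorem bridge_le {n : ℕ} (i j : Fin n) (w : Finset (Fin n) → ℕ∞) (I : Finset (Fin n)) :
    bridge i j w I ≤ w I := by
  unfold bridge; split_ifs <;> simp

theorem bridge_le_exch {n : ℕ} {i j : Fin n} (w : Finset (Fin n) → ℕ∞) {I : Finset (Fin n)}
    (hj : j ∈ I) (hi : i ∉ I) : bridge i j w I ≤ w (exch I j i) + 1 := by
  simp [bridge, hi, hj]

theorem bridge_le_of_eq {n : ℕ} {i j : Fin n} (w : Finset (Fin n) → ℕ∞) {I I' : Finset (Fin n)}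
    (hj : j ∈ I) (hi : i ∉ I) (h : exch I j i = I') : bridge i j w I ≤ w I' + 1 :=
  h ▸ bridge_le_exch w hj hi

/-- The strict inequality in the second alternative matters: it is what excludes the one bad outcome
in `ExchangeIneq.bridge`. -/
theorem bridge_cases {n : ℕ} (i j : Fin n) (w : Finset (Fin n) → ℕ∞) (I : Finset (Fin n)) :
    (bridge i j w I = w I ∧ (j ∈ I → i ∉ I → w I ≤ w (exch I j i) + 1)) ∨
    (j ∈ I ∧ i ∉ I ∧ bridge i j w I = w (exch I j i) + 1 ∧ w (exch I j i) + 1 < w I) := by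
  unfold bridge
  split_ifs with h
  · rcases le_or_gt (w I) (w (exch I j i) + 1) with h1 | h1
    · exact Or.inl ⟨min_eq_left h1, fun _ _ => h1⟩
    · exact Or.inr ⟨h.1, h.2, min_eq_right h1.le, h1⟩
  · exact Or.inl ⟨rfl, fun h1 h2 => absurd ⟨h1, h2⟩ h⟩

/-- The increment 1 keeps every newly created value positive, so a bridge may enlarge the support of
a weight but never changes the set of bases encoded by its zeros. -/
theorem bridge_eq_zero {n : ℕ} (i j : Fin n) (w : Finset (Fin n) → ℕ∞) (I : Finset (Fin n)) :
    bridge i j w I = 0 ↔ w I = 0 := by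
  rcases bridge_cases i j w I with h | ⟨_, _, h, h'⟩
  · rw [h.1]
  · constructor
    · intro h0; rw [h] at h0; simp at h0
    · intro h0; rw [h0] at h'; simp at h'

theorem not_add_le_of_lt {a b p q : ℕ∞} (h1 : a + 1 < b) (h2 : p ≤ q + 1) (hp : a + p ≠ ⊤) :
    ¬ b + q ≤ a + p := by
  intro h
  have ha : a ≠ ⊤ := fun h => hp (by simp [h])
  have hp' : p ≠ ⊤ := fun h => hp (by simp [h])
  have hbq : b + q ≠ ⊤ := ne_top_of_le_ne_top hp h
  have hb : b ≠ ⊤ := fun h => hbq (by simp [h])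
  have hq : q ≠ ⊤ := fun h => hbq (by simp [h])
  lift a to ℕ using ha
  lift b to ℕ using hb
  lift p to ℕ using hp'
  lift q to ℕ using hq
  norm_cast at *
  omega

/-- A set whose weight drops is replaced by its shift I - j + i, the exchange property of `w` is
applied there, and the answer is shifted back; each +1 paid for a bridge on the left matches one on
the right. When the answer is an element touched by the shift and hence not admissible, a second
exchange is made. -/
theorem ExchangeIneq.bridge {n k : ℕ} {w : Finset (Fin n) → ℕ∞} (hw : ExchangeIneq k w)
    {i j : Fin n} (hij : i ≠ j) : ExchangeIneq k (bridge i j w) := by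
  intro I J hI hJ x hxI hxJ
  by_cases htop : PositroidChar.bridge i j w I + PositroidChar.bridge i j w J = ⊤
  · have : ∃ y ∈ J, y ∉ I := by
      by_contra! h
      have h1 : J ⊆ I := h
      exact hxJ (eq_of_subset_of_card_le h1 (by omega) ▸ hxI)
    obtain ⟨y, hy, hy'⟩ := this
    exact ⟨y, hy, hy', by simp [htop]⟩
  rcases bridge_cases i j w I with ⟨eI, lI⟩ | ⟨jI, iI, eI, lI⟩ <;>
    rcases bridge_cases i j w J with ⟨eJ, lJ⟩ | ⟨jJ, iJ, eJ, lJ⟩ <;> rw [eI, eJ] at htop ⊢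
  · obtain ⟨y, hyJ, hyI, h⟩ := hw I J hI hJ x hxI hxJ
    exact ⟨y, hyJ, hyI, (add_le_add (bridge_le ..) (bridge_le ..)).trans h⟩
  · -- only the second set is replaced
    have cJ : (exch J j i).card = k := by rw [card_exch jJ iJ, hJ]
    by_cases hxi : x = i
    · subst hxi
      by_cases jI : j ∈ I
      · obtain ⟨y, hyJ, hyI, h⟩ := hw I _ hI cJ j jI (by simp [mem_exch, hij.symm])
        have hyx : y ≠ x := by grind
        have hyJ' : y ∈ J := by grind [mem_exch]
        refine ⟨y, hyJ', hyI, ?_⟩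
        have h1 : PositroidChar.bridge x j w (exch I x y) ≤ w (exch I j y) + 1 :=
          bridge_le_of_eq w (by grind [mem_exch]) (by grind [mem_exch]) (by ext; grind [mem_exch])
        have h2 : exch J y x = exch (exch J j x) y j := by ext; grind [mem_exch]
        calc _ ≤ (w (exch I j y) + 1) + w (exch (exch J j x) y j) :=
              add_le_add h1 (h2 ▸ bridge_le ..)
          _ = (w (exch I j y) + w (exch (exch J j x) y j)) + 1 := by ring
          _ ≤ (w I + w (exch J j x)) + 1 := by gcongr
          _ = _ := by ring
      · refine ⟨j, jJ, jI, ?_⟩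
        have h1 : PositroidChar.bridge x j w (exch I x j) ≤ w I + 1 :=
          bridge_le_of_eq w (by grind [mem_exch]) (by grind [mem_exch]) (by ext; grind [mem_exch])
        calc _ ≤ (w I + 1) + w (exch J j x) := add_le_add h1 (bridge_le ..)
          _ = _ := by ring
    · obtain ⟨y, hyJ, hyI, h⟩ := hw I _ hI cJ x hxI (by grind [mem_exch])
      by_cases hyi : y = i
      · subst hyi
        by_cases jI : j ∈ I
        · set X := exch I x y with hX
          set Y := exch (exch J j y) y x with hY
          have cX : X.card = k := by rw [hX, card_exch hxI hyI, hI]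
          have cY : Y.card = k := by
            rw [hY, card_exch (by simp [mem_exch]) (by grind [mem_exch]), cJ]
          -- The first exchange returned the shifted-in element, which is not in J, so j is
          -- exchanged between the resulting sets. The answer x would give w(I - j + i) + w(J) ≤
          -- w(I) + w(J - j + i), which the strict drop at J forbids; any other answer is
          -- admissible.
          obtain ⟨z, hzY, hzX, h'⟩ := hw X Y cX cY j (by grind [mem_exch]) (by grind [mem_exch])
          by_cases hzx : z = x
          · subst hzx
            exfalso
            have e1 : exch X j z = exch I j y := by ext; grind [mem_exch]
            have e2 : exch Y z j = J := by ext; grind [mem_exch]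
            rw [e1, e2] at h'
            refine not_add_le_of_lt lJ (lI jI hyI) ?_ (((add_comm _ _).trans_le
              (h'.trans h)).trans_eq (add_comm _ _))
            intro h0
            apply htop
            rw [← add_assoc, add_comm (w I), h0]
            rfl
          · have hzJ : z ∈ J := by grind [mem_exch]
            have hzI : z ∉ I := by grind [mem_exch]
            refine ⟨z, hzJ, hzI, ?_⟩
            have h1 : PositroidChar.bridge y j w (exch I x z) ≤ w (exch X j z) + 1 :=
              bridge_le_of_eq w (by grind [mem_exch]) (by grind [mem_exch])
                (by ext; grind [mem_exch])
            have h2 : exch J z x = exch Y z j := by ext; grind [mem_exch]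
            calc _ ≤ (w (exch X j z) + 1) + w (exch Y z j) :=
                  add_le_add h1 (h2 ▸ bridge_le ..)
              _ = (w (exch X j z) + w (exch Y z j)) + 1 := by ring
              _ ≤ (w I + w (exch J j y)) + 1 := add_le_add (h'.trans h) le_rfl
              _ = _ := by ring
        · refine ⟨j, jJ, jI, ?_⟩
          have h1 : PositroidChar.bridge y j w (exch I x j) ≤ w (exch I x y) + 1 :=
            bridge_le_of_eq w (by grind [mem_exch]) (by grind [mem_exch])
              (by ext; grind [mem_exch])
          have h2 : exch J j x = exch (exch J j y) y x := by ext; grind [mem_exch]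
          calc _ ≤ (w (exch I x y) + 1) + w (exch (exch J j y) y x) :=
                add_le_add h1 (h2 ▸ bridge_le ..)
            _ = (w (exch I x y) + w (exch (exch J j y) y x)) + 1 := by ring
            _ ≤ (w I + w (exch J j y)) + 1 := by gcongr
            _ = _ := by ring
      · refine ⟨y, by grind [mem_exch], hyI, ?_⟩
        have h1 : PositroidChar.bridge i j w (exch J y x) ≤ w (exch (exch J j i) y x) + 1 :=
          bridge_le_of_eq w (by grind [mem_exch]) (by grind [mem_exch]) (by ext; grind [mem_exch])
        calc _ ≤ w (exch I x y) + (w (exch (exch J j i) y x) + 1) :=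
              add_le_add (bridge_le ..) h1
          _ = (w (exch I x y) + w (exch (exch J j i) y x)) + 1 := by ring
          _ ≤ (w I + w (exch J j i)) + 1 := by gcongr
          _ = _ := by ring
  · -- only the first set is replaced
    have cI : (exch I j i).card = k := by rw [card_exch jI iI, hI]
    by_cases hxj : x = j
    · subst hxj
      by_cases iJ : i ∈ J
      · refine ⟨i, iJ, iI, ?_⟩
        have h1 : PositroidChar.bridge i x w (exch J i x) ≤ w J + 1 :=
          bridge_le_of_eq w (by grind [mem_exch]) (by grind [mem_exch]) (by ext; grind [mem_exch])
        calc _ ≤ w (exch I x i) + (w J + 1) := add_le_add (bridge_le ..) h1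
          _ = _ := by ring
      · obtain ⟨y, hyJ, hyI, h⟩ := hw _ J cI hJ i (by simp [mem_exch]) iJ
        refine ⟨y, hyJ, by grind [mem_exch], ?_⟩
        have h1 : PositroidChar.bridge i x w (exch J y x) ≤ w (exch J y i) + 1 :=
          bridge_le_of_eq w (by grind [mem_exch]) (by grind [mem_exch]) (by ext; grind [mem_exch])
        have h2 : exch I x y = exch (exch I x i) i y := by ext; grind [mem_exch]
        calc _ ≤ w (exch (exch I x i) i y) + (w (exch J y i) + 1) :=
              add_le_add (h2 ▸ bridge_le ..) h1
          _ = (w (exch (exch I x i) i y) + w (exch J y i)) + 1 := by ring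
          _ ≤ (w (exch I x i) + w J) + 1 := by gcongr
          _ = _ := by ring
    · obtain ⟨y, hyJ, hyI, h⟩ := hw _ J cI hJ x (by grind [mem_exch]) hxJ
      by_cases hyj : y = j
      · subst hyj
        by_cases iJ : i ∈ J
        · refine ⟨i, iJ, iI, ?_⟩
          have h1 : PositroidChar.bridge i y w (exch J i x) ≤ w (exch J y x) + 1 :=
            bridge_le_of_eq w (by grind [mem_exch]) (by grind [mem_exch])
              (by ext; grind [mem_exch])
          have h2 : exch I x i = exch (exch I y i) x y := by ext; grind [mem_exch]
          calc _ ≤ w (exch (exch I y i) x y) + (w (exch J y x) + 1) :=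
                add_le_add (h2 ▸ bridge_le ..) h1
            _ = (w (exch (exch I y i) x y) + w (exch J y x)) + 1 := by ring
            _ ≤ (w (exch I y i) + w J) + 1 := by gcongr
            _ = _ := by ring
        · set X := exch (exch I y i) x y with hX
          set Y := exch J y x with hY
          have cX : X.card = k := by
            rw [hX, card_exch (by grind [mem_exch]) hyI, cI]
          have cY : Y.card = k := by rw [hY, card_exch hyJ hxJ, hJ]
          -- The mirror situation: the answer j already lies in I, so i is exchanged next, and the
          -- answer x is forbidden by the strict drop at I.
          obtain ⟨z, hzY, hzX, h'⟩ := hw X Y cX cY i (by grind [mem_exch]) (by grind [mem_exch])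
          by_cases hzx : z = x
          · subst hzx
            exfalso
            have e1 : exch X i z = I := by ext; grind [mem_exch]
            have e2 : exch Y z i = exch J y i := by ext; grind [mem_exch]
            rw [e1, e2] at h'
            refine not_add_le_of_lt lI (lJ hyJ iJ) ?_ (h'.trans h)
            intro h0
            apply htop
            rw [add_right_comm, h0]
            rfl
          · have hzJ : z ∈ J := by grind [mem_exch]
            have hzI : z ∉ I := by grind [mem_exch]
            refine ⟨z, hzJ, hzI, ?_⟩
            have h1 : PositroidChar.bridge i y w (exch J z x) ≤ w (exch Y z i) + 1 :=
              bridge_le_of_eq w (by grind [mem_exch]) (by grind [mem_exch])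
                (by ext; grind [mem_exch])
            have h2 : exch I x z = exch X i z := by ext; grind [mem_exch]
            calc _ ≤ w (exch X i z) + (w (exch Y z i) + 1) :=
                  add_le_add (h2 ▸ bridge_le ..) h1
              _ = (w (exch X i z) + w (exch Y z i)) + 1 := by ring
              _ ≤ (w (exch I y i) + w J) + 1 := add_le_add (h'.trans h) le_rfl
              _ = _ := by ring
      · refine ⟨y, hyJ, by grind [mem_exch], ?_⟩
        have h1 : PositroidChar.bridge i j w (exch I x y) ≤ w (exch (exch I j i) x y) + 1 :=
          bridge_le_of_eq w (by grind [mem_exch]) (by grind [mem_exch]) (by ext; grind [mem_exch])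
        calc _ ≤ (w (exch (exch I j i) x y) + 1) + w (exch J y x) :=
              add_le_add h1 (bridge_le ..)
          _ = (w (exch (exch I j i) x y) + w (exch J y x)) + 1 := by ring
          _ ≤ (w (exch I j i) + w J) + 1 := by gcongr
          _ = _ := by ring
  · have cI : (exch I j i).card = k := by rw [card_exch jI iI, hI]
    have cJ : (exch J j i).card = k := by rw [card_exch jJ iJ, hJ]
    obtain ⟨y, hyJ, hyI, h⟩ := hw _ _ cI cJ x (by grind [mem_exch]) (by grind [mem_exch])
    refine ⟨y, by grind [mem_exch], by grind [mem_exch], ?_⟩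
    have h1 : PositroidChar.bridge i j w (exch I x y) ≤ w (exch (exch I j i) x y) + 1 :=
      bridge_le_of_eq w (by grind [mem_exch]) (by grind [mem_exch]) (by ext; grind [mem_exch])
    have h2 : PositroidChar.bridge i j w (exch J y x) ≤ w (exch (exch J j i) y x) + 1 :=
      bridge_le_of_eq w (by grind [mem_exch]) (by grind [mem_exch]) (by ext; grind [mem_exch])
    calc _ ≤ (w (exch (exch I j i) x y) + 1) + (w (exch (exch J j i) y x) + 1) :=
          add_le_add h1 h2
      _ = (w (exch (exch I j i) x y) + w (exch (exch J j i) y x)) + (1 + 1) := by ring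
      _ ≤ (w (exch I j i) + w (exch J j i)) + (1 + 1) := by gcongr
      _ = _ := by ring

/-! ### Bridges between adjacent places preserve the sorting inequality -/

theorem mem_iff_cnt {n : ℕ} (I : Finset (Fin n)) (x : Fin n) :
    x ∈ I ↔ cnt I ((x : ℕ) + 1) = cnt I x + 1 := by
  rw [cnt_succ]; split_ifs with h <;> simp [h]

theorem cnt_le_succ {n : ℕ} (I : Finset (Fin n)) (x : Fin n) :
    cnt I x ≤ cnt I ((x : ℕ) + 1) ∧ cnt I ((x : ℕ) + 1) ≤ cnt I x + 1 := by
  rw [cnt_succ]; split_ifs <;> simp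

/-- The elementary move of a sorted pair when one element of `I` moves to an adjacent place. -/
theorem SortPair.exch_left {n : ℕ} {i j : Fin n} (hij : (j : ℕ) = i + 1 ∨ (i : ℕ) = j + 1)
    {I J K L : Finset (Fin n)} (h : SortPair I J K L) (hj : j ∈ I) (hi : i ∉ I) :
    (j ∈ K ∧ i ∉ K ∧ SortPair (exch I j i) J (exch K j i) L) ∨
    (j ∈ L ∧ i ∉ L ∧ SortPair (exch I j i) J K (exch L j i)) := by
  -- Moving an element between adjacent places changes the counting function only at max i j.
  -- Whether K and L are balanced at that position decides which of them has to follow the move.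
  have key : ((j ∈ K ∧ i ∉ K) ∧ (cnt K (max i j : ℕ) = cnt L (max i j : ℕ) ↔ i < j)) ∨
      ((j ∈ L ∧ i ∉ L) ∧ (cnt K (max i j : ℕ) = cnt L (max i j : ℕ) ↔ j < i)) := by
    rw [mem_iff_cnt] at hj hi
    simp only [mem_iff_cnt, Fin.lt_def]
    have a1 := cnt_le_succ J i
    have a2 := cnt_le_succ J j
    have b1 := cnt_le_succ I i
    have c1 := cnt_le_succ K i
    have c2 := cnt_le_succ K j
    have d1 := cnt_le_succ L i
    have d2 := cnt_le_succ L j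
    have e1 := h i
    have e2 := h j
    have e3 := h ((i : ℕ) + 1)
    have e4 := h ((j : ℕ) + 1)
    rcases hij with hij | hij
    · rw [max_eq_right (by omega)]
      have hX : ∀ X : Finset (Fin n), cnt X ((i : ℕ) + 1) = cnt X j := fun X => by rw [hij]
      have hI := hX I
      have hJ := hX J
      have hK := hX K
      have hL := hX L
      omega
    · rw [max_eq_left (by omega)]
      have hX : ∀ X : Finset (Fin n), cnt X ((j : ℕ) + 1) = cnt X i := fun X => by rw [hij]
      have hI := hX I
      have hJ := hX J
      have hK := hX K
      have hL := hX L
      omega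
  rcases key with ⟨⟨hj', hi'⟩, hk⟩ | ⟨⟨hj', hi'⟩, hk⟩
  · refine Or.inl ⟨hj', hi', fun m => ?_⟩
    have h1 := cnt_exch hj hi m
    have h2 := cnt_exch hj' hi' m
    have h3 := h m
    by_cases hm : m = max (i : ℕ) j
    · subst hm
      rw [Fin.lt_def] at hk
      split_ifs at h1 h2 <;> omega
    · split_ifs at h1 h2 <;> omega
  · refine Or.inr ⟨hj', hi', fun m => ?_⟩
    have h1 := cnt_exch hj hi m
    have h2 := cnt_exch hj' hi' m
    have h3 := h m
    by_cases hm : m = max (i : ℕ) j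
    · subst hm
      rw [Fin.lt_def] at hk
      split_ifs at h1 h2 <;> omega
    · split_ifs at h1 h2 <;> omega

/-- In the multiset union j occurs twice and i not at all, so the alternating distribution gives j
to both K and L and i to neither. -/
theorem SortPair.exch_both {n : ℕ} {i j : Fin n} (hij : (j : ℕ) = i + 1 ∨ (i : ℕ) = j + 1)
    {I J K L : Finset (Fin n)} (h : SortPair I J K L) (hj : j ∈ I) (hi : i ∉ I)
    (hj' : j ∈ J) (hi' : i ∉ J) :
    j ∈ K ∧ i ∉ K ∧ j ∈ L ∧ i ∉ L ∧
      SortPair (exch I j i) (exch J j i) (exch K j i) (exch L j i) := by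
  have key : (j ∈ K ∧ i ∉ K) ∧ (j ∈ L ∧ i ∉ L) := by
    rw [mem_iff_cnt] at hj hi hj' hi'
    simp only [mem_iff_cnt]
    have a1 := cnt_le_succ J i
    have b1 := cnt_le_succ I i
    have c1 := cnt_le_succ K i
    have c2 := cnt_le_succ K j
    have d1 := cnt_le_succ L i
    have d2 := cnt_le_succ L j
    have e1 := h i
    have e2 := h j
    have e3 := h ((i : ℕ) + 1)
    have e4 := h ((j : ℕ) + 1)
    rcases hij with hij | hij
    · have hX : ∀ X : Finset (Fin n), cnt X ((i : ℕ) + 1) = cnt X j := fun X => by rw [hij]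
      have hI := hX I
      have hJ := hX J
      have hK := hX K
      have hL := hX L
      omega
    · have hX : ∀ X : Finset (Fin n), cnt X ((j : ℕ) + 1) = cnt X i := fun X => by rw [hij]
      have hI := hX I
      have hJ := hX J
      have hK := hX K
      have hL := hX L
      omega
  obtain ⟨⟨k1, k2⟩, k3, k4⟩ := key
  refine ⟨k1, k2, k3, k4, fun m => ?_⟩
  have h1 := cnt_exch hj hi m
  have h2 := cnt_exch hj' hi' m
  have h3 := h m
  have h4 := cnt_exch k1 k2 m
  have h5 := cnt_exch k3 k4 m
  omega

/-- For adjacent i and j, sorting commutes with the shift j to i, so the inequality for the shifted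
sets carries back, again with the increments matched one for one. -/
theorem SortIneq.bridge {n k : ℕ} {w : Finset (Fin n) → ℕ∞} (hw : SortIneq k w)
    {i j : Fin n} (hij : (j : ℕ) = i + 1 ∨ (i : ℕ) = j + 1) : SortIneq k (bridge i j w) := by
  have one : ∀ I J K L : Finset (Fin n), I.card = k → J.card = k → K.card = k → L.card = k →
      SortPair I J K L → j ∈ I → i ∉ I →
      PositroidChar.bridge i j w K + PositroidChar.bridge i j w L ≤ (w (exch I j i) + 1) + w J := by
    intro I J K L hI hJ hK hL h jI iI
    have cI : (exch I j i).card = k := by rw [card_exch jI iI, hI]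
    rcases h.exch_left hij jI iI with ⟨h1, h2, h3⟩ | ⟨h1, h2, h3⟩
    · have := hw _ _ _ _ cI hJ (by rw [card_exch h1 h2, hK]) hL h3
      calc _ ≤ (w (exch K j i) + 1) + w L := add_le_add (bridge_le_exch w h1 h2) (bridge_le ..)
        _ = (w (exch K j i) + w L) + 1 := by ring
        _ ≤ (w (exch I j i) + w J) + 1 := by gcongr
        _ = _ := by ring
    · have := hw _ _ _ _ cI hJ hK (by rw [card_exch h1 h2, hL]) h3
      calc _ ≤ w K + (w (exch L j i) + 1) := add_le_add (bridge_le ..) (bridge_le_exch w h1 h2)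
        _ = (w K + w (exch L j i)) + 1 := by ring
        _ ≤ (w (exch I j i) + w J) + 1 := by gcongr
        _ = _ := by ring
  intro I J K L hI hJ hK hL h
  rcases bridge_cases i j w I with ⟨eI, -⟩ | ⟨jI, iI, eI, -⟩ <;>
    rcases bridge_cases i j w J with ⟨eJ, -⟩ | ⟨jJ, iJ, eJ, -⟩ <;> rw [eI, eJ]
  · exact (add_le_add (bridge_le ..) (bridge_le ..)).trans (hw I J K L hI hJ hK hL h)
  · rw [add_comm (w I)]
    exact one J I K L hJ hI hK hL h.symm jJ iJ
  · exact one I J K L hI hJ hK hL h jI iI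
  · obtain ⟨h1, h2, h3, h4, h5⟩ := h.exch_both hij jI iI jJ iJ
    have := hw _ _ _ _ (by rw [card_exch jI iI, hI]) (by rw [card_exch jJ iJ, hJ])
      (by rw [card_exch h1 h2, hK]) (by rw [card_exch h3 h4, hL]) h5
    calc _ ≤ (w (exch K j i) + 1) + (w (exch L j i) + 1) :=
          add_le_add (bridge_le_exch w h1 h2) (bridge_le_exch w h3 h4)
      _ = (w (exch K j i) + w (exch L j i)) + (1 + 1) := by ring
      _ ≤ (w (exch I j i) + w (exch J j i)) + (1 + 1) := by gcongr
      _ = _ := by ring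

/-! ### Weights of full support -/

theorem exists_adjacent_down {n : ℕ} {I : Finset (Fin n)} {x y : Fin n} (hx : x ∉ I) (hy : y ∈ I)
    (hxy : x < y) : ∃ i j : Fin n, (j : ℕ) = i + 1 ∧ j ∈ I ∧ i ∉ I := by
  have hne : (I.filter fun z => x < z).Nonempty := ⟨y, by simp [hy, hxy]⟩
  set j := (I.filter fun z => x < z).min' hne with hj
  have hjm : j ∈ I.filter fun z => x < z := min'_mem _ _
  rw [mem_filter, Fin.lt_def] at hjm
  refine ⟨⟨j - 1, by omega⟩, j, by simp; omega, hjm.1, fun h => ?_⟩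
  by_cases h' : (⟨j - 1, by omega⟩ : Fin n) = x
  · exact hx (h' ▸ h)
  · have h'' : (j : ℕ) - 1 ≠ x := fun e => h' (Fin.ext e)
    have := min'_le (I.filter fun z => x < z) ⟨j - 1, by omega⟩
      (by rw [mem_filter, Fin.lt_def]; exact ⟨h, by simp; omega⟩)
    rw [← hj, Fin.le_def] at this
    simp only at this
    omega

/-- Adjacent downward moves lower the sum of the elements and can stop only at the first k places,
so all k-sets are connected through that one. -/
theorem mem_of_closed_adjacent {n k : ℕ} {P : Finset (Fin n) → Prop}
    (hP : ∀ I : Finset (Fin n), I.card = k → ∀ i j : Fin n, (j : ℕ) = i + 1 → j ∈ I → i ∉ I →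
      (P I ↔ P (exch I j i)))
    {I J : Finset (Fin n)} (hI : I.card = k) (hJ : J.card = k) (h : P I) : P J := by
  have init : ∀ N : ℕ, ∀ I : Finset (Fin n), I.card = k → ∑ x ∈ I, (x : ℕ) = N →
      (P I ↔ P (univ.filter fun x : Fin n => (x : ℕ) < k)) := by
    intro N
    induction N using Nat.strong_induction_on with
    | _ N ih =>
      intro I hI hN
      by_cases hx : ∃ x y : Fin n, x ∉ I ∧ y ∈ I ∧ x < y
      · obtain ⟨x, y, hx, hy, hxy⟩ := hx
        obtain ⟨i, j, hij, hj, hi⟩ := exists_adjacent_down hx hy hxy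
        rw [hP I hI i j hij hj hi]
        refine ih (∑ x ∈ exch I j i, (x : ℕ)) ?_ _ (by rw [card_exch hj hi, hI]) rfl
        rw [exch, sum_insert (fun h => hi (mem_of_mem_erase h)), ← hN, ← add_sum_erase _ _ hj]
        omega
      · push Not at hx
        have : I = univ.filter fun x : Fin n => (x : ℕ) < k := by
          have hkn : k ≤ n := by
            have := card_le_univ I
            simp at this; omega
          have hc : (univ.filter fun x : Fin n => (x : ℕ) < k).card = k := by
            rw [Fin.card_filter_val_lt]
            omega
          refine eq_of_subset_of_card_le (fun y hy => ?_) (by omega)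
          rw [mem_filter]
          refine ⟨mem_univ _, ?_⟩
          have hsub : Iic y ⊆ I := by
            intro z hz
            rcases (mem_Iic.mp hz).eq_or_lt with rfl | h
            · exact hy
            · by_contra hzI
              exact absurd h (not_lt.mpr (hx z y hzI hy))
          have := card_le_card hsub
          rw [Fin.card_Iic, hI] at this
          omega
        rw [← this]
  exact (init _ J hJ rfl).mpr ((init _ I hI rfl).mp h)

/-- A weight function satisfying the exchange and sorting inequalities can be extended to one of
full support with the same zeros. -/
theorem exists_full_support {n k : ℕ} {w₀ : Finset (Fin n) → ℕ∞} (h1 : ExchangeIneq k w₀)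
    (h2 : SortIneq k w₀) {I₀ : Finset (Fin n)} (hI₀ : I₀.card = k) (h0 : w₀ I₀ = 0) :
    ∃ w : Finset (Fin n) → ℕ∞, ExchangeIneq k w ∧ SortIneq k w ∧ (∀ I, w I = 0 ↔ w₀ I = 0) ∧
      ∀ I : Finset (Fin n), I.card = k → w I ≠ ⊤ := by
  classical
  let bad : (Finset (Fin n) → ℕ∞) → ℕ := fun w => (univ.filter fun I => w I = ⊤).card
  let Q : ℕ → Prop := fun N => ∃ w : Finset (Fin n) → ℕ∞, ExchangeIneq k w ∧ SortIneq k w ∧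
    (∀ I, w I = 0 ↔ w₀ I = 0) ∧ bad w = N
  have hQ : ∃ N, Q N := ⟨_, w₀, h1, h2, fun _ => Iff.rfl, rfl⟩
  -- Among the admissible weights, `w` has the fewest infinite values. An infinite value next to a
  -- finite one could be removed by a bridge, so finiteness spreads along adjacent moves from I₀ to
  -- all k-sets.
  obtain ⟨w, hw1, hw2, hw3, hw4⟩ := Nat.find_spec hQ
  refine ⟨w, hw1, hw2, hw3, ?_⟩
  have step : ∀ i j : Fin n, ((j : ℕ) = i + 1 ∨ (i : ℕ) = j + 1) → ∀ I : Finset (Fin n),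
      j ∈ I → i ∉ I → w (exch I j i) ≠ ⊤ → w I ≠ ⊤ := by
    intro i j hij I hj hi h hI
    have hne : i ≠ j := by rintro rfl; exact hi hj
    have hlt : bad (bridge i j w) < bad w := by
      refine card_lt_card ⟨fun J hJ => ?_, fun hsub => ?_⟩
      · simp only [mem_filter, mem_univ, true_and] at hJ ⊢
        exact top_le_iff.mp (hJ ▸ bridge_le i j w J)
      · have := @hsub I (by simp [hI])
        simp only [mem_filter, mem_univ, true_and] at this
        have hle := bridge_le_exch w hj hi
        rw [this, top_le_iff] at hle
        exact h (by simpa using hle)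
    refine Nat.find_min hQ (hw4 ▸ hlt) ⟨bridge i j w, hw1.bridge hne, hw2.bridge hij,
      fun J => (bridge_eq_zero i j w J).trans (hw3 J), rfl⟩
  intro I hI
  refine mem_of_closed_adjacent (k := k) (P := fun I => w I ≠ ⊤) ?_ hI₀ hI
    (by rw [(hw3 I₀).mpr h0]; simp)
  intro I hI i j hij hj hi
  refine ⟨fun h => ?_, step i j (Or.inl hij) I hj hi⟩
  refine step j i (Or.inr hij) (exch I j i) (by simp [mem_exch]) ?_ ?_
  · rw [mem_exch]; rintro (rfl | h) <;> grind
  · have : exch (exch I j i) i j = I := by ext; grind [mem_exch]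
    rwa [this]

/-- The tropical three-term relation follows from the exchange and sorting inequalities. -/
theorem three_term_of_ineq {n k : ℕ} {w : Finset (Fin n) → ℕ∞} (h1 : ExchangeIneq k w)
    (h2 : SortIneq k w) {S : Finset (Fin n)} (hS : S.card + 2 = k) {a b c d : Fin n}
    (hab : a < b) (hbc : b < c) (hcd : c < d) (ha : a ∉ S) (hb : b ∉ S) (hc : c ∉ S)
    (hd : d ∉ S) :
    w (S ∪ {a, c}) + w (S ∪ {b, d}) =
      min (w (S ∪ {a, b}) + w (S ∪ {c, d})) (w (S ∪ {a, d}) + w (S ∪ {b, c})) := by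
  have hcard : ∀ x y, x ≠ y → x ∉ S → y ∉ S → (S ∪ {x, y}).card = k := by
    intro x y hxy hx hy
    rw [card_union_of_disjoint (by simp [hx, hy]), card_pair hxy, hS]
  have hcnt : ∀ x y, x ≠ y → x ∉ S → y ∉ S → ∀ m, cnt (S ∪ {x, y}) m =
      cnt S m + (if (x : ℕ) < m then 1 else 0) + (if (y : ℕ) < m then 1 else 0) := by
    intro x y hxy hx hy m
    rw [cnt, filter_union, card_union_of_disjoint, filter_insert, filter_singleton]
    · have hxy' : x ∉ ({y} : Finset (Fin n)) := by simpa using hxy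
      split_ifs <;> simp [cnt, hxy]
    · exact disjoint_filter_filter (by simp [hx, hy])
  have hac := hab.trans hbc
  have hbd := hbc.trans hcd
  have had := hab.trans hbd
  -- For ≤: the two diagonals are the sorted form of either pair of opposite sides. For ≥:
  -- exchanging a out of S+ac against S+bd can only bring in b or d, which gives one of the two
  -- pairs of sides.
  apply le_antisymm
  · refine le_min (h2 _ _ _ _ ?_ ?_ ?_ ?_ ?_) (h2 _ _ _ _ ?_ ?_ ?_ ?_ ?_)
    all_goals first
      | exact hcard _ _ hab.ne ha hb
      | exact hcard _ _ hcd.ne hc hd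
      | exact hcard _ _ hac.ne ha hc
      | exact hcard _ _ hbd.ne hb hd
      | exact hcard _ _ had.ne ha hd
      | exact hcard _ _ hbc.ne hb hc
      | skip
    all_goals
      intro m
      simp only [hcnt _ _ hab.ne ha hb, hcnt _ _ hcd.ne hc hd, hcnt _ _ hac.ne ha hc,
        hcnt _ _ hbd.ne hb hd, hcnt _ _ had.ne ha hd, hcnt _ _ hbc.ne hb hc]
      rw [Fin.lt_def] at hab hbc hcd
      split_ifs <;> omega
  · obtain ⟨y, hy, hy', h⟩ := h1 (S ∪ {a, c}) (S ∪ {b, d}) (hcard _ _ hac.ne ha hc)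
      (hcard _ _ hbd.ne hb hd) a (by simp) (by simp [ha, hab.ne, had.ne])
    have hyS : y ∉ S := fun h => hy' (by simp [h])
    simp only [mem_union, hyS, false_or, mem_insert, mem_singleton] at hy
    have hac' := hac.ne
    have hab' := hab.ne
    have had' := had.ne
    have hbc' := hbc.ne
    have hbd' := hbd.ne
    have hcd' := hcd.ne
    rcases hy with rfl | rfl
    · have e1 : exch (S ∪ {a, c}) a y = S ∪ {y, c} := by ext; grind [mem_exch]
      have e2 : exch (S ∪ {y, d}) y a = S ∪ {a, d} := by ext; grind [mem_exch]
      rw [e1, e2, add_comm] at h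
      exact (min_le_right _ _).trans h
    · have e1 : exch (S ∪ {a, c}) a y = S ∪ {c, y} := by ext; grind [mem_exch]
      have e2 : exch (S ∪ {b, y}) y a = S ∪ {a, b} := by ext; grind [mem_exch]
      rw [e1, e2, add_comm] at h
      exact (min_le_left _ _).trans h

end PositroidChar

namespace PositroidChar

open Finset

/-! ### Matroids satisfying the positive three-term condition -/

/-- Let C be the fundamental circuit of x in B₂. If C - x lay in the closure of B₁ - x, so would x.
Hence some y in C - x lies outside that closure; y replaces x in B₁, and, being on C, is replaced by
x in B₂. -/
theorem IsBase.symm_exchange {α : Type*} {M : Matroid α} {B₁ B₂ : Set α} (h₁ : M.IsBase B₁)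
    (h₂ : M.IsBase B₂) {x : α} (hx₁ : x ∈ B₁) (hx₂ : x ∉ B₂) :
    ∃ y ∈ B₂, y ∉ B₁ ∧ M.IsBase (insert y (B₁ \ {x})) ∧ M.IsBase (insert x (B₂ \ {y})) := by
  have hxE : x ∈ M.E := h₁.subset_ground hx₁
  have hxcl : x ∈ M.closure B₂ := by rw [h₂.closure_eq]; exact hxE
  have hC := h₂.fundCircuit_isCircuit hxE hx₂
  have hxC := hC.mem_closure_sdiff_singleton_of_mem (M.mem_fundCircuit x B₂)
  have hnot := h₁.indep.notMem_closure_sdiff_of_mem hx₁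
  have hsub : ¬ M.fundCircuit x B₂ \ {x} ⊆ M.closure (B₁ \ {x}) := fun h =>
    hnot (M.closure_subset_closure_of_subset_closure h hxC)
  obtain ⟨y, hyC, hy⟩ := Set.not_subset.mp hsub
  have hyB₂ : y ∈ B₂ := by
    rcases M.fundCircuit_subset_insert x B₂ hyC.1 with h | h
    · exact absurd h hyC.2
    · exact h
  have hyE := h₂.subset_ground hyB₂
  have hI₁ := h₁.indep.sdiff {x}
  have hy1 := (hI₁.notMem_closure_iff hyE).mp hy
  have hyB₁ : y ∉ B₁ := fun h => hy1.2 ⟨h, hyC.2⟩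
  refine ⟨y, hyB₂, hyB₁, h₁.exchange_isBase_of_indep hyB₁ hy1.1, ?_⟩
  have := (h₂.indep.mem_fundCircuit_iff hxcl hx₂).mp hyC.1
  have hxy : x ≠ y := fun e => hyC.2 e.symm
  rw [Set.insert_sdiff_singleton_comm hxy]
  exact h₂.exchange_isBase_of_indep' hyB₂ hx₂ this

theorem coe_exch {n : ℕ} (I : Finset (Fin n)) (x y : Fin n) :
    ((exch I x y : Finset (Fin n)) : Set (Fin n)) = insert y ((I : Set (Fin n)) \ {x}) := by
  simp [exch]

theorem isBase_symm_exch {n : ℕ} {M : Matroid (Fin n)} {I J : Finset (Fin n)}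
    (hI : M.IsBase (I : Set (Fin n))) (hJ : M.IsBase (J : Set (Fin n))) {x : Fin n} (hxI : x ∈ I)
    (hxJ : x ∉ J) :
    ∃ y ∈ J, y ∉ I ∧ M.IsBase (exch I x y : Set (Fin n)) ∧
      M.IsBase (exch J y x : Set (Fin n)) := by
  obtain ⟨y, h1, h2, h3, h4⟩ := IsBase.symm_exchange hI hJ (mem_coe.mpr hxI) (by simpa using hxJ)
  exact ⟨y, by simpa using h1, by simpa using h2, by rwa [coe_exch], by rwa [coe_exch]⟩

/-- The matroid condition corresponding to the three-term Plücker relation with positive signs. -/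
def PosThreeTerm {n : ℕ} (M : Matroid (Fin n)) : Prop :=
  ∀ (S : Finset (Fin n)) (a b c d : Fin n), a < b → b < c → c < d →
    a ∉ S → b ∉ S → c ∉ S → d ∉ S →
    (M.IsBase (S ∪ {a, b} : Finset (Fin n)) ∧ M.IsBase (S ∪ {c, d} : Finset (Fin n))) ∨
      (M.IsBase (S ∪ {a, d} : Finset (Fin n)) ∧ M.IsBase (S ∪ {b, c} : Finset (Fin n))) →
    M.IsBase (S ∪ {a, c} : Finset (Fin n)) ∧ M.IsBase (S ∪ {b, d} : Finset (Fin n))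

/-! ### Cyclic intervals and sorting of bases -/

/-- The cyclically next element of a nonempty set `N`. -/
theorem exists_next {n : ℕ} {N : Finset (Fin n)} (hN : N.Nonempty) (y : Fin n) :
    ∃ z ∈ N, (y < z ∧ ∀ t ∈ N, y < t → z ≤ t) ∨ ((∀ t ∈ N, t ≤ y) ∧ ∀ t ∈ N, z ≤ t) := by
  by_cases h : (N.filter (y < ·)).Nonempty
  · have := min'_mem _ h
    rw [mem_filter] at this
    exact ⟨_, this.1, Or.inl ⟨this.2, fun t ht hyt => min'_le _ _ (by simp [ht, hyt])⟩⟩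
  · refine ⟨N.min' hN, min'_mem _ _, Or.inr ⟨fun t ht => ?_, fun t ht => min'_le _ _ ht⟩⟩
    by_contra hty
    exact h ⟨t, by simp [ht, not_le.mp hty]⟩

/-- Elements of `F` with the same cyclically next element outside `F` form a cyclic interval. -/
theorem next_fiber {n : ℕ} {N : Finset (Fin n)} (hN : N.Nonempty) {nxt : Fin n → Fin n}
    (hn : ∀ y, nxt y ∈ N ∧ ((y < nxt y ∧ ∀ t ∈ N, y < t → nxt y ≤ t) ∨
      ((∀ t ∈ N, t ≤ y) ∧ ∀ t ∈ N, nxt y ≤ t))) {y₀ : Fin n} (hy₀ : y₀ ∉ N) :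
    ∃ a b : ℕ, a ≤ b ∧
      ((∀ y : Fin n, (y ∉ N ∧ nxt y = nxt y₀) ↔ (a ≤ (y : ℕ) ∧ (y : ℕ) < b)) ∨
       (∀ y : Fin n, (y ∉ N ∧ nxt y = nxt y₀) ↔ ¬ (a ≤ (y : ℕ) ∧ (y : ℕ) < b))) := by
  have hmin : ∀ t ∈ N, N.min' hN ≤ t := fun t ht => min'_le _ _ ht
  have hmax : ∀ t ∈ N, t ≤ N.max' hN := fun t ht => le_max' _ _ ht
  have hminN := min'_mem N hN
  have hmaxN := max'_mem N hN
  -- With elements of N on both sides of y₀ the fibre is the gap strictly between two consecutive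
  -- elements of N. Otherwise it is the wrap-around gap, the complement of the interval from the
  -- least to the greatest element of N.
  by_cases hc : (N.filter (· < y₀)).Nonempty ∧ (N.filter (y₀ < ·)).Nonempty
  · obtain ⟨h1, h2⟩ := hc
    set p := (N.filter (· < y₀)).max' h1 with hp
    have hpm := max'_mem _ h1
    rw [← hp, mem_filter] at hpm
    have hpx : ∀ t ∈ N, t < y₀ → t ≤ p := fun t ht hty => le_max' _ _ (by simp [ht, hty])
    obtain ⟨q, hq⟩ := h2
    rw [mem_filter] at hq
    have hz := hn y₀
    have hz2 : y₀ < nxt y₀ ∧ ∀ t ∈ N, y₀ < t → nxt y₀ ≤ t := by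
      rcases hz.2 with h | h
      · exact h
      · exact absurd hq.2 (not_lt.mpr (h.1 q hq.1))
    refine ⟨p + 1, nxt y₀, ?_, Or.inl fun y => ?_⟩
    · have := hpm.2.trans hz2.1
      rw [Fin.lt_def] at this
      omega
    · have e1 : (p : ℕ) + 1 ≤ y ↔ p < y := by rw [Fin.lt_def]; omega
      have e2 : (y : ℕ) < nxt y₀ ↔ y < nxt y₀ := Fin.lt_def.symm
      rw [e1, e2]
      have hy := hn y
      constructor
      · rintro ⟨hyN, he⟩
        rw [he] at hy
        rcases hy.2 with h | h
        · refine ⟨?_, h.1⟩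
          by_contra hpy
          have hyp : y < p := lt_of_le_of_ne (not_lt.mp hpy) (fun e => hyN (e ▸ hpm.1))
          have := h.2 p hpm.1 hyp
          exact absurd (this.trans_lt hpm.2) (not_lt.mpr hz2.1.le)
        · have := h.2 p hpm.1
          exact absurd (this.trans_lt hpm.2) (not_lt.mpr hz2.1.le)
      · rintro ⟨hpy, hyz⟩
        have hyN : y ∉ N := by
          intro hyN
          rcases lt_trichotomy y y₀ with h | h | h
          · exact absurd hpy (not_lt.mpr (hpx y hyN h))
          · exact hy₀ (h ▸ hyN)
          · exact absurd hyz (not_lt.mpr (hz2.2 y hyN h))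
        refine ⟨hyN, ?_⟩
        rcases hy.2 with h | h
        · refine le_antisymm (h.2 _ hz.1 hyz) ?_
          have hne : nxt y ≠ y₀ := fun e => hy₀ (e ▸ hy.1)
          rcases lt_or_gt_of_ne hne with h' | h'
          · exact absurd (h.1.trans_le (hpx _ hy.1 h')) (not_lt.mpr hpy.le)
          · exact hz2.2 _ hy.1 h'
        · exact absurd (h.1 _ hz.1) (not_le.mpr hyz)
  · have hz : nxt y₀ = N.min' hN := by
      have hz := hn y₀
      rcases hz.2 with h | h
      · refine le_antisymm ?_ (hmin _ hz.1)
        refine h.2 _ hminN ?_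
        have hne : N.min' hN ≠ y₀ := fun e => hy₀ (e ▸ hminN)
        refine lt_of_le_of_ne (not_lt.mp fun h' => hc ⟨⟨N.min' hN, ?_⟩, ⟨nxt y₀, ?_⟩⟩) hne.symm
        · simp [hminN, h']
        · simp [hz.1, h.1]
      · exact le_antisymm (h.2 _ hminN) (hmin _ hz.1)
    refine ⟨N.min' hN, N.max' hN + 1, ?_, Or.inr fun y => ?_⟩
    · have := hmin _ hmaxN
      rw [Fin.le_def] at this
      omega
    · rw [hz]
      have e1 : (N.min' hN : ℕ) ≤ y ↔ N.min' hN ≤ y := Fin.le_def.symm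
      have e2 : (y : ℕ) < N.max' hN + 1 ↔ y ≤ N.max' hN := by rw [Fin.le_def]; omega
      rw [e1, e2]
      have hy := hn y
      constructor
      · rintro ⟨hyN, he⟩ ⟨h1, h2⟩
        rw [he] at hy
        rcases hy.2 with h | h
        · exact absurd h.1 (not_lt.mpr h1)
        · exact hyN (le_antisymm h2 (h.1 _ hmaxN) ▸ hmaxN)
      · intro h
        have hyN : y ∉ N := fun hyN => h ⟨hmin _ hyN, hmax _ hyN⟩
        refine ⟨hyN, ?_⟩
        rcases hy.2 with h' | h'
        · refine le_antisymm (h'.2 _ hminN ?_) (hmin _ hy.1)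
          by_contra hlt
          exact h ⟨not_lt.mp hlt, h'.1.le.trans (hmax _ hy.1)⟩
        · exact le_antisymm (h'.2 _ hminN) (hmin _ hy.1)

/-- If two elements are not crossed by a pair of elements of `N`, they have the same next element. -/
theorem next_eq_of_not_cross {n : ℕ} {N : Finset (Fin n)} {nxt : Fin n → Fin n}
    (hn : ∀ y, nxt y ∈ N ∧ ((y < nxt y ∧ ∀ t ∈ N, y < t → nxt y ≤ t) ∨
      ((∀ t ∈ N, t ≤ y) ∧ ∀ t ∈ N, nxt y ≤ t))) {p q : Fin n} (hpN : p ∉ N) (hqN : q ∉ N)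
    (hpq : p < q)
    (h : ¬ ((∃ z ∈ N, p < z ∧ z < q) ∧ (∃ z ∈ N, z < p ∨ q < z))) : nxt p = nxt q := by
  have hp := hn p
  have hq := hn q
  by_cases h1 : ∃ z ∈ N, p < z ∧ z < q
  · have h2 : ∀ z ∈ N, p < z ∧ z < q := by
      intro z hz
      by_contra h3
      refine h ⟨h1, z, hz, ?_⟩
      by_contra! h4
      exact h3 ⟨lt_of_le_of_ne h4.1 (fun e => hpN (e ▸ hz)),
        lt_of_le_of_ne h4.2 (fun e => hqN (e ▸ hz))⟩
    grind
  · push Not at h1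
    grind

theorem card_filter_Ico {n : ℕ} (I : Finset (Fin n)) {a b : ℕ} (hab : a ≤ b) :
    (I.filter fun y : Fin n => a ≤ (y : ℕ) ∧ (y : ℕ) < b).card + cnt I a = cnt I b := by
  rw [cnt, cnt, ← card_union_of_disjoint]
  · congr 1
    ext y
    simp only [mem_union, mem_filter]
    constructor
    · rintro (h | h)
      · exact ⟨h.1, h.2.2⟩
      · exact ⟨h.1, h.2.trans_le hab⟩
    · intro h
      by_cases h' : a ≤ (y : ℕ)
      · exact Or.inl ⟨h.1, h', h.2⟩
      · exact Or.inr ⟨h.1, not_le.mp h'⟩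
  · rw [disjoint_filter]
    intro y _ h1 h2
    omega

theorem card_filter_not_Ico {n : ℕ} (I : Finset (Fin n)) {a b : ℕ} (hab : a ≤ b) :
    (I.filter fun y : Fin n => ¬ (a ≤ (y : ℕ) ∧ (y : ℕ) < b)).card + cnt I b =
      I.card + cnt I a := by
  have h1 := card_filter_Ico I hab
  have h2 := card_filter_add_card_filter_not (s := I)
    (fun y : Fin n => a ≤ (y : ℕ) ∧ (y : ℕ) < b)
  omega

/-- If X is not a base it lies in a hyperplane F. The gaps of the complement N of F are cyclic
intervals, and `PosThreeTerm` makes F decompose along them: no fundamental circuit meets two gaps.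
As X has one element more than the rank of F, it overfills some gap, whereas every base, in
particular I and J, respects the rank of each gap. This contradicts `hu` for an ordinary interval
and `hl` for a wrap-around one, since the complement of an interval is bounded above when the
interval is bounded below. -/
theorem isBase_of_between {n : ℕ} {M : Matroid (Fin n)} (hE : M.E = Set.univ)
    (hM : PosThreeTerm M) {I J X : Finset (Fin n)} (hI : M.IsBase (I : Set (Fin n)))
    (hJ : M.IsBase (J : Set (Fin n))) (hX : X.card = I.card)
    (hu : ∀ a b, a ≤ b → cnt X b + cnt I a ≤ cnt X a + cnt I b ∨
      cnt X b + cnt J a ≤ cnt X a + cnt J b)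
    (hl : ∀ a b, a ≤ b → cnt X a + cnt I b ≤ cnt X b + cnt I a ∨
      cnt X a + cnt J b ≤ cnt X b + cnt J a) : M.IsBase (X : Set (Fin n)) := by
  classical
  by_contra hXB
  have hsub : ∀ A : Set (Fin n), A ⊆ M.E := fun A => hE ▸ Set.subset_univ A
  have hmemE : ∀ x, x ∈ M.E := fun x => hE ▸ Set.mem_univ x
  have hcard : ∀ B : Finset (Fin n), M.IsBase (B : Set (Fin n)) → B.card = I.card := by
    intro B hB
    have := hB.encard_eq_encard_of_isBase hI
    simpa using this
  -- an independent set spanning a hyperplane that contains `X`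
  obtain ⟨B', x, hxB', hB, hXF⟩ : ∃ (B' : Finset (Fin n)) (x : Fin n), x ∉ B' ∧
      M.IsBase (insert x B' : Finset (Fin n)) ∧
      (X : Set (Fin n)) ⊆ M.closure (B' : Set (Fin n)) := by
    obtain ⟨I₀, hI₀⟩ := M.exists_isBasis (X : Set (Fin n)) (hsub _)
    obtain ⟨B, hB, hIB⟩ := hI₀.indep.exists_isBase_superset
    have hne : ¬ B ⊆ I₀ := by
      intro hBI
      have hBX : B ⊆ X := hBI.trans hI₀.subset
      lift B to Finset (Fin n) using Set.toFinite B
      have := eq_of_subset_of_card_le (coe_subset.mp hBX) (by rw [hcard B hB, hX])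
      exact hXB (this ▸ hB)
    obtain ⟨x, hxB, hxI⟩ := Set.not_subset.mp hne
    lift B to Finset (Fin n) using Set.toFinite B
    refine ⟨B.erase x, x, by simp, by rwa [insert_erase (mem_coe.mp hxB)], ?_⟩
    refine hI₀.subset_closure.trans (M.closure_subset_closure ?_)
    intro y hy
    rw [mem_coe, mem_erase]
    exact ⟨fun e => hxI (e ▸ hy), hIB hy⟩
  have hB'i : M.Indep (B' : Set (Fin n)) := hB.indep.subset (by simp)
  have hB'c : B'.card + 1 = I.card := by rw [← hcard _ hB, card_insert_of_notMem hxB']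
  set F := M.closure (B' : Set (Fin n)) with hF
  have hB'F : (B' : Set (Fin n)) ⊆ F := M.subset_closure _ (hsub _)
  let N : Finset (Fin n) := univ.filter fun z => z ∉ F
  have hNmem : ∀ z, z ∈ N ↔ z ∉ F := fun z => by simp [N]
  have hxF : x ∉ F := by
    have := hB.indep.notMem_closure_sdiff_of_mem (e := x) (by simp)
    simpa [hxB', hF] using this
  have hNne : N.Nonempty := ⟨x, (hNmem x).mpr hxF⟩
  have hins : ∀ z, z ∉ F → M.IsBase (insert z B' : Finset (Fin n)) := by
    intro z hz
    have h1 := (hB'i.notMem_closure_iff (hmemE z)).mp hz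
    have h2 := Matroid.insert_isBase_of_insert_indep (M := M) (I := (B' : Set (Fin n))) (e := x)
      (f := z) (by simpa using hxB') h1.2 (by simpa using hB) h1.1
    simpa using h2
  choose nxt hnN hn' using fun y => exists_next hNne y
  have hn : ∀ y, nxt y ∈ N ∧ ((y < nxt y ∧ ∀ t ∈ N, y < t → nxt y ≤ t) ∨
      ((∀ t ∈ N, t ≤ y) ∧ ∀ t ∈ N, nxt y ≤ t)) := fun y => ⟨hnN y, hn' y⟩
  -- fundamental circuits do not leave the fibres of `nxt`
  have hcross : ∀ (S : Finset (Fin n)) (p q : Fin n), p < q → p ∈ F → q ∈ F → p ∉ S → q ∉ S →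
      (S : Set (Fin n)) ⊆ F → (∀ z, z ∉ F → M.IsBase (S ∪ {p, z} : Finset (Fin n))) →
      (∀ z, z ∉ F → M.IsBase (S ∪ {q, z} : Finset (Fin n))) → nxt p = nxt q := by
    intro S p q hpq hpF hqF hpS hqS hSF hp hq
    have hnb : ¬ M.IsBase (S ∪ {p, q} : Finset (Fin n)) := by
      intro hb
      have h1 : M.closure (S ∪ {p, q} : Finset (Fin n)) ⊆ F := by
        refine M.closure_subset_closure_of_subset_closure ?_
        intro t ht
        simp only [coe_union, coe_insert, coe_singleton, Set.mem_union, Set.mem_insert_iff,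
          Set.mem_singleton_iff] at ht
        rcases ht with ht | rfl | rfl
        · exact hSF ht
        · exact hpF
        · exact hqF
      rw [hb.closure_eq] at h1
      exact hxF (h1 (hmemE x))
    refine next_eq_of_not_cross hn (fun h => (hNmem p).mp h hpF) (fun h => (hNmem q).mp h hqF)
      hpq ?_
    -- Here z and z' separate p from q cyclically, so {p, q} is a diagonal and S+pz', S+qz (or S+pz,
    -- S+qz') are opposite sides that are bases; the condition would make S+pq a base, although it
    -- lies in F.
    rintro ⟨⟨z, hz, hpz, hzq⟩, z', hz', hlt⟩
    rw [hNmem] at hz hz'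
    have hzS : z ∉ S := fun h => hz (hSF h)
    have hzS' : z' ∉ S := fun h => hz' (hSF h)
    rcases hlt with hlt | hlt
    · refine hnb (hM S z' p z q hlt hpz hzq hzS' hpS hzS hqS (Or.inl ⟨?_, ?_⟩)).2
      · rw [pair_comm]; exact hp z' hz'
      · rw [pair_comm]; exact hq z hz
    · exact hnb (hM S p z q z' hpz hzq hlt hpS hzS hqS hzS' (Or.inl ⟨hp z hz, hq z' hz'⟩)).1
  have hfiber : ∀ y ∈ F, y ∈ M.closure (B'.filter fun u => nxt u = nxt y : Finset (Fin n)) := by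
    intro y hyF
    by_cases hyB : y ∈ B'
    · exact M.mem_closure_of_mem (by simp [hyB]) (hsub _)
    have hyB' : y ∉ (B' : Set (Fin n)) := by simpa using hyB
    have hC := hB'i.fundCircuit_isCircuit hyF hyB'
    refine M.closure_subset_closure ?_
      (hC.mem_closure_sdiff_singleton_of_mem (M.mem_fundCircuit y _))
    rintro u ⟨huC, huy⟩
    have huB : u ∈ B' := by
      rcases M.fundCircuit_subset_insert y _ huC with h | h
      · exact absurd h huy
      · exact h
    simp only [coe_filter, Set.mem_ofPred_eq]
    refine ⟨huB, ?_⟩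
    have huF : u ∈ F := hB'F huB
    have hyu : y ≠ u := fun e => huy e.symm
    have hSF : ((B'.erase u : Finset (Fin n)) : Set (Fin n)) ⊆ F := fun t ht =>
      hB'F (mem_of_mem_erase (mem_coe.mp ht))
    have h1 : ∀ z, z ∉ F → M.IsBase (B'.erase u ∪ {u, z} : Finset (Fin n)) := by
      intro z hz
      have : B'.erase u ∪ {u, z} = insert z B' := by ext; grind
      rw [this]
      exact hins z hz
    have h2 : ∀ z, z ∉ F → M.IsBase (B'.erase u ∪ {y, z} : Finset (Fin n)) := by
      intro z hz
      have hb := hins z hz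
      have hyz : y ≠ z := fun e => hz (e ▸ hyF)
      have hyb : y ∉ ((insert z B' : Finset (Fin n)) : Set (Fin n)) := by simp [hyz, hyB]
      have hyc : y ∈ M.closure (insert z B' : Finset (Fin n)) := by
        rw [hb.closure_eq]; exact hmemE y
      -- The circuit of y over B' is also its circuit over the base B' + z, which permits swapping u
      -- for y in that base.
      have hCe : M.fundCircuit y (B' : Set (Fin n)) =
          M.fundCircuit y ((insert z B' : Finset (Fin n)) : Set (Fin n)) := by
        refine hC.eq_fundCircuit_of_subset hb.indep ?_
        refine (M.fundCircuit_subset_insert y _).trans (Set.insert_subset_insert ?_)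
        simp
      rw [hCe, hb.indep.mem_fundCircuit_iff hyc hyb] at huC
      have h3 := hb.exchange_isBase_of_indep' (e := u) (f := y) (by simp [huB]) hyb huC
      have : ((B'.erase u ∪ {y, z} : Finset (Fin n)) : Set (Fin n)) =
          insert y ((insert z B' : Finset (Fin n)) : Set (Fin n)) \ {u} := by
        have hzu : z ≠ u := fun e => hz (e ▸ huF)
        ext t
        simp only [coe_union, coe_erase, coe_insert, coe_singleton, Set.mem_union,
          Set.mem_sdiff, Set.mem_insert_iff, Set.mem_singleton_iff, mem_coe]
        grind
      rw [this]
      convert h3 using 1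
    rcases lt_or_gt_of_ne hyu with h | h
    · exact (hcross (B'.erase u) y u h hyF huF (by simp [hyB]) (by simp) hSF h2 h1).symm
    · exact hcross (B'.erase u) u y h huF hyF (by simp) (by simp [hyB]) hSF h1 h2
  -- a fibre in which `X` has too many elements
  obtain ⟨z, hz⟩ : ∃ z, (B'.filter fun u => nxt u = z).card < (X.filter fun u => nxt u = z).card := by
    have h1 := card_eq_sum_card_fiberwise (f := nxt) (s := B') (t := univ) (by simp)
    have h2 := card_eq_sum_card_fiberwise (f := nxt) (s := X) (t := univ) (by simp)
    obtain ⟨z, -, hz⟩ := exists_lt_of_sum_lt (s := univ)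
      (f := fun z => (B'.filter fun u => nxt u = z).card)
      (g := fun z => (X.filter fun u => nxt u = z).card) (by rw [← h1, ← h2]; omega)
    exact ⟨z, hz⟩
  obtain ⟨y₀, hy₀⟩ := card_pos.mp (lt_of_le_of_lt (Nat.zero_le _) hz)
  obtain ⟨hy₀X, rfl⟩ := mem_filter.mp hy₀
  have hy₀F : y₀ ∈ F := hXF hy₀X
  -- The part of a base A in the gap is independent and, by `hfiber`, spanned by the part of B' in
  -- that gap.
  have hle : ∀ A : Finset (Fin n), M.IsBase (A : Set (Fin n)) →
      (A.filter fun y => y ∉ N ∧ nxt y = nxt y₀).card ≤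
        (B'.filter fun u => nxt u = nxt y₀).card := by
    intro A hA
    have hAi : M.Indep (A.filter fun y => y ∉ N ∧ nxt y = nxt y₀ : Finset (Fin n)) :=
      hA.indep.subset (coe_subset.mpr (filter_subset _ _))
    have h1 := hAi.encard_le_eRk_of_subset
      (X := M.closure (B'.filter fun u => nxt u = nxt y₀ : Finset (Fin n))) (by
        intro y hy
        simp only [coe_filter, Set.mem_ofPred_eq, hNmem, not_not] at hy
        have := hfiber y hy.2.1
        rwa [hy.2.2] at this)
    rw [Matroid.eRk_closure_eq, (hB'i.subset (coe_subset.mpr (filter_subset _ _))).eRk_eq_encard] at h1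
    simpa only [Set.encard_coe_eq_coe_finsetCard, Nat.cast_le] using h1
  have hXe : (X.filter fun u => nxt u = nxt y₀) =
      X.filter fun y => y ∉ N ∧ nxt y = nxt y₀ := by
    refine filter_congr fun y hy => ?_
    rw [hNmem, not_not]
    exact ⟨fun h => ⟨hXF hy, h⟩, fun h => h.2⟩
  rw [hXe] at hz
  have hIle := hle I hI
  have hJle := hle J hJ
  have hJc := hcard J hJ
  obtain ⟨a, b, hab, hfib | hfib⟩ := next_fiber hNne hn (y₀ := y₀)
    (fun h => (hNmem y₀).mp h hy₀F)
  · simp only [hfib] at hz hIle hJle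
    have e1 := card_filter_Ico I hab
    have e2 := card_filter_Ico J hab
    have e3 := card_filter_Ico X hab
    have e4 := hu a b hab
    omega
  · simp only [hfib] at hz hIle hJle
    have e1 := card_filter_not_Ico I hab
    have e2 := card_filter_not_Ico J hab
    have e3 := card_filter_not_Ico X hab
    have e4 := hl a b hab
    omega

/-- On every interval the counts of K and L differ by at most 1 and have the same sum as those of I
and J, so neither K nor L can exceed, or fall below, both I and J there. -/
theorem PosThreeTerm.isBase_of_sortPair {n : ℕ} {M : Matroid (Fin n)} (hE : M.E = Set.univ)
    (hM : PosThreeTerm M) {I J K L : Finset (Fin n)} (hI : M.IsBase (I : Set (Fin n)))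
    (hJ : M.IsBase (J : Set (Fin n))) (hK : K.card = I.card) (hL : L.card = I.card)
    (h : SortPair I J K L) : M.IsBase (K : Set (Fin n)) ∧ M.IsBase (L : Set (Fin n)) := by
  constructor
  · refine isBase_of_between hE hM hI hJ hK (fun a b _ => ?_) (fun a b _ => ?_) <;>
    · have h1 := h a
      have h2 := h b
      omega
  · refine isBase_of_between hE hM hI hJ hL (fun a b _ => ?_) (fun a b _ => ?_) <;>
    · have h1 := h a
      have h2 := h b
      omega

/-- A matroid satisfying the positive three-term condition is the zero set of a finite weight
satisfying the tropical three-term relations. -/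
theorem PosThreeTerm.exists_weight {n k : ℕ} {M : Matroid (Fin n)} (hE : M.E = Set.univ)
    (hk : M.eRank = k) (hM : PosThreeTerm M) :
    ∃ w : Finset (Fin n) → ℕ,
      (∀ I : Finset (Fin n), M.IsBase (I : Set (Fin n)) ↔ I.card = k ∧ w I = 0) ∧
      ∀ (S : Finset (Fin n)) (a b c d : Fin n), S.card + 2 = k → a < b → b < c → c < d →
        a ∉ S → b ∉ S → c ∉ S → d ∉ S →
        w (S ∪ {a, c}) + w (S ∪ {b, d}) =
          min (w (S ∪ {a, b}) + w (S ∪ {c, d})) (w (S ∪ {a, d}) + w (S ∪ {b, c})) := by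
  classical
  have hcard : ∀ B : Finset (Fin n), M.IsBase (B : Set (Fin n)) → B.card = k := by
    intro B hB
    have := hB.encard_eq_eRank
    rw [hk] at this
    simpa using this
  -- For this 0/∞ weight the exchange inequality is symmetric basis exchange, and the sorting
  -- inequality says that sorted bases are bases.
  let w₀ : Finset (Fin n) → ℕ∞ := fun I => if M.IsBase (I : Set (Fin n)) then 0 else ⊤
  have hw₀ : ∀ I, w₀ I = 0 ↔ M.IsBase (I : Set (Fin n)) := fun I => by
    simp only [w₀]; split_ifs with h <;> simp [h]
  have h1 : ExchangeIneq k w₀ := by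
    intro I J hI hJ x hxI hxJ
    by_cases hb : M.IsBase (I : Set (Fin n)) ∧ M.IsBase (J : Set (Fin n))
    · obtain ⟨y, hyJ, hyI, h1, h2⟩ := isBase_symm_exch hb.1 hb.2 hxI hxJ
      exact ⟨y, hyJ, hyI, by simp [(hw₀ _).mpr h1, (hw₀ _).mpr h2]⟩
    · have : ∃ y ∈ J, y ∉ I := by
        by_contra! h
        exact hxJ (eq_of_subset_of_card_le (show J ⊆ I from h) (by omega) ▸ hxI)
      obtain ⟨y, hyJ, hyI⟩ := this
      refine ⟨y, hyJ, hyI, ?_⟩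
      have : w₀ I + w₀ J = ⊤ := by
        simp only [w₀]
        split_ifs <;> simp_all
      simp [this]
  have h2 : SortIneq k w₀ := by
    intro I J K L hI hJ hK hL h
    by_cases hb : M.IsBase (I : Set (Fin n)) ∧ M.IsBase (J : Set (Fin n))
    · obtain ⟨h1, h2⟩ := hM.isBase_of_sortPair hE hb.1 hb.2 (hK.trans hI.symm)
        (hL.trans hI.symm) h
      simp [(hw₀ _).mpr h1, (hw₀ _).mpr h2]
    · have : w₀ I + w₀ J = ⊤ := by
        simp only [w₀]
        split_ifs <;> simp_all
      simp [this]
  obtain ⟨B, hB⟩ := M.exists_isBase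
  lift B to Finset (Fin n) using Set.toFinite B
  obtain ⟨w, hw1, hw2, hw3, hw4⟩ := exists_full_support h1 h2 (hcard B hB) ((hw₀ B).mpr hB)
  refine ⟨fun I => (w I).toNat, fun I => ⟨fun h => ⟨hcard I h, ?_⟩, fun h => ?_⟩, ?_⟩
  · simp [(hw3 I).mpr ((hw₀ I).mpr h)]
  · rw [← hw₀, ← hw3]
    exact (ENat.toNat_eq_zero.mp h.2).resolve_right (hw4 I h.1)
  · intro S a b c d hS hab hbc hcd ha hb hc hd
    have hne : ∀ x y, x ≠ y → x ∉ S → y ∉ S → w (S ∪ {x, y}) ≠ ⊤ := by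
      intro x y hxy hx hy
      refine hw4 _ ?_
      rw [card_union_of_disjoint (by simp [hx, hy]), card_pair hxy, hS]
    have hac := hab.trans hbc
    have hbd := hbc.trans hcd
    have had := hab.trans hbd
    have := three_term_of_ineq hw1 hw2 hS hab hbc hcd ha hb hc hd
    rw [← ENat.natCast_toNat (hne _ _ hab.ne ha hb), ← ENat.natCast_toNat (hne _ _ hcd.ne hc hd),
      ← ENat.natCast_toNat (hne _ _ hac.ne ha hc), ← ENat.natCast_toNat (hne _ _ hbd.ne hb hd),
      ← ENat.natCast_toNat (hne _ _ had.ne ha hd), ← ENat.natCast_toNat (hne _ _ hbc.ne hb hc)] at this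
    rw [← Nat.cast_add, ← Nat.cast_add, ← Nat.cast_add,
      ← (Nat.mono_cast (α := ℕ∞)).map_min] at this
    exact Nat.cast_injective this

end PositroidChar

namespace PositroidChar

open Finset

/-! ### Functions comparable to a power of the parameter -/

/-- On `(0, 1]` the function `f` is bounded above and below by positive multiples of `t ^ e`. -/
def PowComparable (f : ℝ → ℝ) (e : ℕ) : Prop :=
  ∃ c C : ℝ, 0 < c ∧ 0 < C ∧ ∀ t, 0 < t → t ≤ 1 → c * t ^ e ≤ f t ∧ f t ≤ C * t ^ e

theorem PowComparable.mul {f g : ℝ → ℝ} {a b : ℕ} (hf : PowComparable f a)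
    (hg : PowComparable g b) : PowComparable (fun t => f t * g t) (a + b) := by
  obtain ⟨c, C, hc, hC, h⟩ := hf
  obtain ⟨d, D, hd, hD, h'⟩ := hg
  refine ⟨c * d, C * D, by positivity, by positivity, fun t h0 h1 => ?_⟩
  obtain ⟨h2, h3⟩ := h t h0 h1
  obtain ⟨h4, h5⟩ := h' t h0 h1
  have p1 : 0 < c * t ^ a := by positivity
  have p2 : 0 < d * t ^ b := by positivity
  constructor
  · calc c * d * t ^ (a + b) = (c * t ^ a) * (d * t ^ b) := by ring
      _ ≤ f t * g t := mul_le_mul h2 h4 p2.le (p1.le.trans h2)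
  · calc f t * g t ≤ (C * t ^ a) * (D * t ^ b) :=
        mul_le_mul h3 h5 (p2.le.trans h4) (by positivity)
      _ = C * D * t ^ (a + b) := by ring

/-- Both functions are positive on (0, 1], so there is no cancellation and the smaller exponent
dominates: orders add tropically. -/
theorem PowComparable.add {f g : ℝ → ℝ} {a b : ℕ} (hf : PowComparable f a)
    (hg : PowComparable g b) : PowComparable (fun t => f t + g t) (min a b) := by
  wlog hab : a ≤ b generalizing f g a b
  · have := this hg hf (le_of_not_ge hab)
    rw [min_comm]
    simpa only [add_comm] using this
  obtain ⟨c, C, hc, hC, h⟩ := hf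
  obtain ⟨d, D, hd, hD, h'⟩ := hg
  rw [min_eq_left hab]
  refine ⟨c, C + D, hc, by positivity, fun t h0 h1 => ?_⟩
  obtain ⟨h2, h3⟩ := h t h0 h1
  obtain ⟨h4, h5⟩ := h' t h0 h1
  have p2 : 0 < d * t ^ b := by positivity
  have p3 : D * t ^ b ≤ D * t ^ a :=
    mul_le_mul_of_nonneg_left (pow_le_pow_of_le_one h0.le h1 hab) hD.le
  constructor <;> linarith

theorem PowComparable.of_mul {f g h : ℝ → ℝ} {a b : ℕ} (hg : PowComparable g b)
    (hh : PowComparable h (a + b)) (he : ∀ t, 0 < t → t ≤ 1 → f t * g t = h t) :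
    PowComparable f a := by
  obtain ⟨c, C, hc, hC, h1⟩ := hg
  obtain ⟨d, D, hd, hD, h2⟩ := hh
  refine ⟨d / C, D / c, by positivity, by positivity, fun t h0 ht => ?_⟩
  obtain ⟨h3, h4⟩ := h1 t h0 ht
  obtain ⟨h5, h6⟩ := h2 t h0 ht
  rw [← he t h0 ht] at h5 h6
  have p1 : 0 < c * t ^ b := by positivity
  have hgpos : 0 < g t := p1.trans_le h3
  have p2 : 0 < d * t ^ (a + b) := by positivity
  have hfpos : 0 < f t := pos_of_mul_pos_left (p2.trans_le h5) hgpos.le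
  have tb : 0 < t ^ b := by positivity
  constructor
  · have : d * t ^ a * t ^ b ≤ f t * C * t ^ b := by
      calc d * t ^ a * t ^ b = d * t ^ (a + b) := by ring
        _ ≤ f t * g t := h5
        _ ≤ f t * (C * t ^ b) := mul_le_mul_of_nonneg_left h4 hfpos.le
        _ = _ := by ring
    rw [div_mul_eq_mul_div, div_le_iff₀ hC]
    exact le_of_mul_le_mul_right this tb
  · have : f t * c * t ^ b ≤ D * t ^ a * t ^ b := by
      calc f t * c * t ^ b = f t * (c * t ^ b) := by ring
        _ ≤ f t * g t := mul_le_mul_of_nonneg_left h3 hfpos.le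
        _ ≤ D * t ^ (a + b) := h6
        _ = _ := by ring
    rw [div_mul_eq_mul_div, le_div_iff₀ hc]
    exact le_of_mul_le_mul_right this tb

/-! ### Changing one column -/

theorem minor_updateRow_smul {n k : ℕ} (A : Matrix (Fin k) (Fin n) ℝ) (r : Fin k) (s : ℝ)
    (I : Finset (Fin n)) : minor (A.updateRow r (s • A r)) I = s * minor A I := by
  by_cases h : I.card = k
  · rw [minor_eq _ h, minor_eq _ h, colDet, colDet]
    have : (A.updateRow r (s • A r)).submatrix id (I.orderEmbOfFin h) =
        (A.submatrix id (I.orderEmbOfFin h)).updateRow r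
          (s • (A.submatrix id (I.orderEmbOfFin h)) r) := by
      ext i j
      by_cases hi : i = r
      · subst hi; simp
      · simp [hi]
    rw [this, Matrix.det_updateRow_smul, Matrix.updateRow_eq_self]
  · simp [minor, h]

theorem minor_updateCol_of_notMem {n k : ℕ} (A : Matrix (Fin k) (Fin n) ℝ) {μ : Fin n}
    {I : Finset (Fin n)} (hμ : μ ∉ I) (x : Fin k → ℝ) : minor (A.updateCol μ x) I = minor A I := by
  by_cases h : I.card = k
  · rw [minor_eq _ h, minor_eq _ h, colDet, colDet]
    congr 1
    ext i j
    have : I.orderEmbOfFin h j ≠ μ := fun e => hμ (e ▸ I.orderEmbOfFin_mem h j)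
    simp [this]
  · simp [minor, h]

theorem minor_updateCol_add_smul {n k : ℕ} (A : Matrix (Fin k) (Fin n) ℝ) {μ : Fin n}
    {I : Finset (Fin n)} (hμ : μ ∈ I) (x y : Fin k → ℝ) (s : ℝ) :
    minor (A.updateCol μ (x + s • y)) I =
      minor (A.updateCol μ x) I + s * minor (A.updateCol μ y) I := by
  by_cases h : I.card = k
  · obtain ⟨i₀, hi₀⟩ : ∃ i, I.orderEmbOfFin h i = μ := by
      have := Set.ext_iff.mp (I.range_orderEmbOfFin h) μ
      simpa only [Set.mem_range, mem_coe, hμ, iff_true] using this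
    have key : ∀ z : Fin k → ℝ, minor (A.updateCol μ z) I =
        ((A.submatrix id (I.orderEmbOfFin h)).updateCol i₀ z).det := by
      intro z
      rw [minor_eq _ h, colDet]
      congr 1
      ext i j
      have : I.orderEmbOfFin h j = μ ↔ j = i₀ := by
        rw [← hi₀]; exact (I.orderEmbOfFin h).injective.eq_iff
      simp [Matrix.updateCol_apply, this]
    rw [key, key, key, Matrix.det_updateCol_add, Matrix.det_updateCol_smul]
  · simp [minor, h]

/-- A copy of column l in place μ repeats a column of T, or else replaces μ by l up to a reordering
of columns, whence the absolute value. -/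
theorem abs_minor_updateCol_col {n k : ℕ} (A : Matrix (Fin k) (Fin n) ℝ) {μ l : Fin n}
    {T : Finset (Fin n)} (hμ : μ ∉ T) (hT : T.card + 1 = k) :
    |minor (A.updateCol μ (fun r => A r l)) (insert μ T)| =
      if l ∈ T then 0 else |minor A (insert l T)| := by
  have h : (insert μ T).card = k := by rw [card_insert_of_notMem hμ, hT]
  set f := (insert μ T).orderEmbOfFin h with hf
  have hrange : ∀ z, (∃ i, f i = z) ↔ z ∈ insert μ T := by
    intro z
    have := Set.ext_iff.mp ((insert μ T).range_orderEmbOfFin h) z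
    simpa only [Set.mem_range, mem_coe] using this
  let g : Fin k → Fin n := fun i => if f i = μ then l else f i
  have hg : minor (A.updateCol μ (fun r => A r l)) (insert μ T) = colDet A g := by
    rw [minor_eq _ h, colDet, colDet]
    congr 1
    ext i j
    by_cases hj : f j = μ
    · simp [g, ← hf, hj]
    · simp [g, ← hf, hj]
  rw [hg]
  obtain ⟨i₀, hi₀⟩ := (hrange μ).mpr (mem_insert_self _ _)
  split_ifs with hl
  · obtain ⟨i₁, hi₁⟩ := (hrange l).mpr (mem_insert_of_mem hl)
    have hlμ : l ≠ μ := fun e => hμ (e ▸ hl)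
    rw [colDet_eq_zero, abs_zero]
    intro hinj
    have : i₀ = i₁ := hinj (by simp [g, hi₀, hi₁, hlμ])
    exact hlμ (by rw [← hi₁, ← this, hi₀])
  · have hfT : ∀ i, f i ≠ μ → f i ∈ T := fun i hi =>
      (mem_insert.mp ((hrange _).mp ⟨i, rfl⟩)).resolve_left hi
    refine abs_colDet ?_ ?_ A
    · intro i j hij
      simp only [g] at hij
      split_ifs at hij with h1 h2 h2
      · exact f.injective (h1.trans h2.symm)
      · exact absurd (hij ▸ hfT j h2) hl
      · exact absurd (hij ▸ hfT i h1) hl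
      · exact f.injective hij
    · ext z
      simp only [mem_image, mem_univ, true_and, mem_insert, g]
      constructor
      · rintro ⟨i, rfl⟩
        split_ifs with h1
        · exact Or.inl rfl
        · exact Or.inr (hfT i h1)
      · rintro (rfl | hz)
        · exact ⟨i₀, by simp [hi₀]⟩
        · obtain ⟨i, hi⟩ := (hrange z).mpr (mem_insert_of_mem hz)
          have : z ≠ μ := fun e => hμ (e ▸ hz)
          exact ⟨i, by simp [hi, this]⟩

/-! ### Realizing tropical weights -/

/-- The union of an initial segment and a final segment of the first `m` places, with `p` and
`q` elements respectively. -/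
def twoSegments (n m p q : ℕ) : Finset (Fin n) :=
  (univ.filter fun x : Fin n => (x : ℕ) < p) ∪
    univ.filter fun x : Fin n => m - q ≤ (x : ℕ) ∧ (x : ℕ) < m

theorem mem_twoSegments {n m p q : ℕ} {x : Fin n} :
    x ∈ twoSegments n m p q ↔ (x : ℕ) < p ∨ (m - q ≤ (x : ℕ) ∧ (x : ℕ) < m) := by
  simp [twoSegments]

theorem card_twoSegments {n m p q : ℕ} (hm : m ≤ n) (h : p + q ≤ m) :
    (twoSegments n m p q).card = p + q := by
  rw [twoSegments, card_union_of_disjoint, Fin.card_filter_val_lt]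
  · have h1 := card_filter_Ico (univ : Finset (Fin n)) (show m - q ≤ m by omega)
    rw [cnt, cnt, Fin.card_filter_val_lt, Fin.card_filter_val_lt] at h1
    omega
  · rw [disjoint_filter]
    intro x _ h1 h2
    omega

/-- The linear system for the new column is triangular, and p is treated from k - 1 downwards.
Adding a multiple of column p₀ does not affect the conditions with p > p₀, since p₀ then lies in the
initial segment, while for p = p₀ its coefficient is, up to sign, a minor on old columns, nonzero by
`hA`. -/
theorem exists_column {n k m : ℕ} (hkm : k ≤ m) (hmn : m < n) (A : Matrix (Fin k) (Fin n) ℝ)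
    (hA : ∀ I : Finset (Fin n), I.card = k → (∀ x ∈ I, (x : ℕ) < m) → minor A I ≠ 0)
    (v : ℕ → ℝ) :
    ∃ x : Fin k → ℝ, ∀ p < k, minor (A.updateCol ⟨m, hmn⟩ x)
      (insert ⟨m, hmn⟩ (twoSegments n m p (k - 1 - p))) = v p := by
  set μ : Fin n := ⟨m, hmn⟩ with hμ
  have hμT : ∀ p < k, μ ∉ twoSegments n m p (k - 1 - p) := by
    intro p hp h
    rw [mem_twoSegments] at h
    simp only [hμ] at h
    omega
  have hcard : ∀ p < k, (twoSegments n m p (k - 1 - p)).card + 1 = k := by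
    intro p hp
    rw [card_twoSegments hmn.le (by omega)]
    omega
  suffices H : ∀ q ≤ k, ∃ x : Fin k → ℝ, ∀ p, k - q ≤ p → p < k → minor (A.updateCol μ x)
      (insert μ (twoSegments n m p (k - 1 - p))) = v p by
    obtain ⟨x, hx⟩ := H k le_rfl
    exact ⟨x, fun p hp => hx p (by omega) hp⟩
  intro q
  induction q with
  | zero => exact fun _ => ⟨0, fun p h1 h2 => by omega⟩
  | succ q ih =>
    intro hq
    obtain ⟨x, hx⟩ := ih (by omega)
    set p₀ := k - (q + 1) with hp₀
    let l : Fin n := ⟨p₀, by omega⟩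
    have habs : ∀ p < k, _ := fun p hp =>
      abs_minor_updateCol_col A (l := l) (hμT p hp) (hcard p hp)
    have hne : minor (A.updateCol μ (fun r => A r l))
        (insert μ (twoSegments n m p₀ (k - 1 - p₀))) ≠ 0 := by
      have hl : l ∉ twoSegments n m p₀ (k - 1 - p₀) := by
        rw [mem_twoSegments]
        simp only [l]
        omega
      have := habs p₀ (by omega)
      rw [if_neg hl] at this
      rw [← abs_pos, this, abs_pos]
      refine hA _ (by rw [card_insert_of_notMem hl, hcard p₀ (by omega)]) ?_
      intro z hz
      rw [mem_insert, mem_twoSegments] at hz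
      rcases hz with rfl | hz
      · simp only [l]; omega
      · omega
    set δ := minor (A.updateCol μ (fun r => A r l))
        (insert μ (twoSegments n m p₀ (k - 1 - p₀))) with hδ
    set β := minor (A.updateCol μ x) (insert μ (twoSegments n m p₀ (k - 1 - p₀))) with hβ
    refine ⟨x + ((v p₀ - β) / δ) • (fun r => A r l), fun p h1 h2 => ?_⟩
    rw [minor_updateCol_add_smul _ (mem_insert_self _ _)]
    by_cases hp : p = p₀
    · rw [hp, ← hδ, ← hβ]
      field_simp
      ring
    · have hl : l ∈ twoSegments n m p (k - 1 - p) := by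
        rw [mem_twoSegments]
        simp only [l]
        omega
      have := habs p h2
      rw [if_pos hl, abs_eq_zero] at this
      rw [this, hx p (by omega) h2]
      ring

/-- The elements of `T` that have elements outside `T` both below and above them. -/
def inner {n : ℕ} (m : ℕ) (T : Finset (Fin n)) : Finset (Fin n) :=
  T.filter fun b => (∃ a, a ∉ T ∧ a < b) ∧ ∃ c, c ∉ T ∧ b < c ∧ (c : ℕ) < m

theorem mem_inner {n m : ℕ} {T : Finset (Fin n)} {b : Fin n} : b ∈ inner m T ↔
    b ∈ T ∧ (∃ a, a ∉ T ∧ a < b) ∧ ∃ c, c ∉ T ∧ b < c ∧ (c : ℕ) < m := by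
  simp [inner]

theorem eq_twoSegments {n m k : ℕ} (hkm : k ≤ m) (hmn : m < n) {T : Finset (Fin n)}
    (hTm : ∀ x ∈ T, (x : ℕ) < m) (hT : T.card + 1 = k) (hin : inner m T = ∅) :
    ∃ p < k, T = twoSegments n m p (k - 1 - p) := by
  have hne : Tᶜ.Nonempty := ⟨⟨m, hmn⟩, by
    rw [mem_compl]
    intro h
    exact absurd (hTm _ h) (by simp)⟩
  set p := Tᶜ.min' hne with hp
  have hpT : p ∉ T := mem_compl.mp (min'_mem _ _)
  have hlow : ∀ x, x < p → x ∈ T := by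
    intro x hx
    by_contra h
    exact absurd hx (not_lt.mpr (min'_le _ _ (mem_compl.mpr h)))
  have hIio : Iio p ⊆ T := fun x hx => hlow x (mem_Iio.mp hx)
  have hpk : (p : ℕ) < k := by
    have := card_le_card hIio
    rw [Fin.card_Iio] at this
    omega
  refine ⟨p, hpk, eq_of_subset_of_card_le ?_ ?_⟩
  · intro b hb
    rw [mem_twoSegments]
    by_cases hbp : b < p
    · exact Or.inl hbp
    · refine Or.inr ⟨?_, hTm b hb⟩
      have hbp' : p < b := lt_of_le_of_ne (not_lt.mp hbp) (fun e => hpT (e ▸ hb))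
      have hup : ∀ c, b < c → (c : ℕ) < m → c ∈ T := by
        intro c hbc hcm
        by_contra hcT
        have : b ∈ inner m T := mem_inner.mpr ⟨hb, ⟨p, hpT, hbp'⟩, c, hcT, hbc, hcm⟩
        rw [hin] at this
        exact absurd this (notMem_empty _)
      have hsub : Iio p ∪ Ico b ⟨m, hmn⟩ ⊆ T := by
        refine union_subset hIio fun c hc => ?_
        rw [mem_Ico] at hc
        rcases hc.1.eq_or_lt with rfl | h
        · exact hb
        · exact hup c h hc.2
      have hd : Disjoint (Iio p) (Ico b ⟨m, hmn⟩) := by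
        rw [disjoint_left]
        intro z hz hz'
        exact absurd ((mem_Iio.mp hz).trans (hbp'.trans_le (mem_Ico.mp hz').1)) (lt_irrefl _)
      have := card_le_card hsub
      rw [card_union_of_disjoint hd, Fin.card_Iio, Fin.card_Ico] at this
      simp only at this
      omega
  · rw [card_twoSegments hmn.le (by omega)]
    omega

/-- Only elements strictly between the extreme gaps a and c are inner. Moving b into one of these
gaps places it outside that range and creates no new inner element, so the recursion terminates. -/
theorem inner_exch_ssubset {n m : ℕ} {T : Finset (Fin n)} {a b c : Fin n} (hb : b ∈ T)
    (ha : a ∉ T) (hab : a < b) (hamin : ∀ x, x ∉ T → a ≤ x)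
    (hc : c ∉ T) (hbc : b < c) (hcm : (c : ℕ) < m)
    (hcmax : ∀ x, x ∉ T → (x : ℕ) < m → x ≤ c) :
    inner m (exch T b a) ⊂ inner m T ∧ inner m (exch T b c) ⊂ inner m T := by
  have hbi : b ∈ inner m T := mem_inner.mpr ⟨hb, ⟨a, ha, hab⟩, c, hc, hbc, hcm⟩
  have hcases : ∀ {x y z : Fin n}, x ∉ exch T y z → x = y ∨ x ∉ T := by
    intro x y z h
    rw [mem_exch] at h
    by_cases hxy : x = y
    · exact Or.inl hxy
    · exact Or.inr fun hx => h (Or.inr ⟨hxy, hx⟩)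
  have key : ∀ x e, x ∈ inner m (exch T b e) → a < x ∧ x < c := by
    intro x e hx
    obtain ⟨-, ⟨a', ha', hax⟩, c', hc', hxc, hcm'⟩ := mem_inner.mp hx
    constructor
    · rcases hcases ha' with rfl | h
      · exact hab.trans hax
      · exact (hamin a' h).trans_lt hax
    · rcases hcases hc' with rfl | h
      · exact hxc.trans hbc
      · exact hxc.trans_le (hcmax c' h hcm')
  have main : ∀ e, e = a ∨ e = c → inner m (exch T b e) ⊂ inner m T := by
    intro e he
    refine ⟨fun x hx => ?_, fun h => ?_⟩
    · obtain ⟨h1, h2⟩ := key x e hx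
      refine mem_inner.mpr ⟨?_, ⟨a, ha, h1⟩, c, hc, h2, hcm⟩
      rcases mem_exch.mp (mem_inner.mp hx).1 with rfl | h
      · rcases he with rfl | rfl
        · exact absurd h1 (lt_irrefl _)
        · exact absurd h2 (lt_irrefl _)
      · exact h.2
    · rcases mem_exch.mp (mem_inner.mp (h hbi)).1 with rfl | h'
      · rcases he with rfl | rfl
        · exact absurd hab (lt_irrefl _)
        · exact absurd hbc (lt_irrefl _)
      · exact h'.1 rfl
  exact ⟨main a (Or.inl rfl), main c (Or.inr rfl)⟩

theorem insert_exch_eq {n : ℕ} (T : Finset (Fin n)) (μ b e : Fin n) :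
    insert μ (exch T b e) = T.erase b ∪ {e, μ} := by
  ext z
  simp only [mem_insert, mem_exch, mem_union, mem_erase, mem_singleton]
  tauto

theorem insert_eq_erase_union {n : ℕ} {T : Finset (Fin n)} (μ : Fin n) {b : Fin n} (hb : b ∈ T) :
    insert μ T = T.erase b ∪ {b, μ} := by
  rw [← insert_exch_eq, exch, insert_erase hb]

/-- The orders of all functions `F (insert μ T)`, where `μ` is the last place, are determined by
those of the sets `T` consisting of an initial and a final segment. -/
theorem powComparable_insert {n k m : ℕ} (hkm : k ≤ m) (hmn : m < n) {w : Finset (Fin n) → ℕ}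
    (hw : ∀ (S : Finset (Fin n)) (a b c d : Fin n), S.card + 2 = k → a < b → b < c → c < d →
        a ∉ S → b ∉ S → c ∉ S → d ∉ S →
        w (S ∪ {a, c}) + w (S ∪ {b, d}) =
          min (w (S ∪ {a, b}) + w (S ∪ {c, d})) (w (S ∪ {a, d}) + w (S ∪ {b, c})))
    {F : Finset (Fin n) → ℝ → ℝ}
    (hF : ∀ (S : Finset (Fin n)) (a b c d : Fin n), S.card + 2 = k → a < b → b < c → c < d →
        a ∉ S → b ∉ S → c ∉ S → d ∉ S → ∀ t,
        F (S ∪ {a, c}) t * F (S ∪ {b, d}) t =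
          F (S ∪ {a, b}) t * F (S ∪ {c, d}) t + F (S ∪ {a, d}) t * F (S ∪ {b, c}) t)
    (hold : ∀ I : Finset (Fin n), I.card = k → (∀ z ∈ I, (z : ℕ) < m) →
      PowComparable (F I) (w I))
    (hseg : ∀ p < k, PowComparable (F (insert ⟨m, hmn⟩ (twoSegments n m p (k - 1 - p))))
      (w (insert ⟨m, hmn⟩ (twoSegments n m p (k - 1 - p)))))
    (N : ℕ) (T : Finset (Fin n)) (hN : (inner m T).card = N) (hT : T.card + 1 = k)
    (hlt : ∀ z ∈ T, (z : ℕ) < m) :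
    PowComparable (F (insert ⟨m, hmn⟩ T)) (w (insert ⟨m, hmn⟩ T)) := by
  induction N using Nat.strong_induction_on generalizing T with
  | _ N ihN =>
    by_cases hin : inner m T = ∅
    · obtain ⟨p, hp, rfl⟩ := eq_twoSegments hkm hmn hlt hT hin
      exact hseg p hp
    obtain ⟨b, hb⟩ := nonempty_iff_ne_empty.mpr hin
    obtain ⟨hbT, ⟨a₀, ha₀, hab₀⟩, c₀, hc₀, hbc₀, hcm₀⟩ := mem_inner.mp hb
    obtain ⟨a, haT, hamin⟩ : ∃ a, a ∉ T ∧ ∀ z, z ∉ T → a ≤ z := by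
      have hane : Tᶜ.Nonempty := ⟨a₀, mem_compl.mpr ha₀⟩
      exact ⟨_, mem_compl.mp (min'_mem _ hane), fun z hz => min'_le _ _ (mem_compl.mpr hz)⟩
    have hab : a < b := (hamin a₀ ha₀).trans_lt hab₀
    obtain ⟨c, hcT, hcm, hcmax⟩ : ∃ c, c ∉ T ∧ (c : ℕ) < m ∧
        ∀ z, z ∉ T → (z : ℕ) < m → z ≤ c := by
      have hcne : (Tᶜ.filter fun z : Fin n => (z : ℕ) < m).Nonempty :=
        ⟨c₀, by simp [hc₀, hcm₀]⟩
      have hcmem := max'_mem _ hcne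
      rw [mem_filter, mem_compl] at hcmem
      exact ⟨_, hcmem.1, hcmem.2, fun z hz hzm => le_max' _ _ (by simp [hz, hzm])⟩
    have hbc : b < c := hbc₀.trans_le (hcmax c₀ hc₀ hcm₀)
    have hcμ : c < ⟨m, hmn⟩ := hcm
    have hμT : (⟨m, hmn⟩ : Fin n) ∉ T := fun h => absurd (hlt _ h) (by simp)
    obtain ⟨hs1, hs2⟩ := inner_exch_ssubset hbT haT hab hamin hcT hbc hcm hcmax
    have hSc : (T.erase b).card + 2 = k := by
      have := card_erase_add_one hbT
      omega
    have hSm : ∀ z ∈ T.erase b, (z : ℕ) < m := fun z hz => hlt z (mem_of_mem_erase hz)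
    have haS : a ∉ T.erase b := fun h => haT (mem_of_mem_erase h)
    have hcS : c ∉ T.erase b := fun h => hcT (mem_of_mem_erase h)
    have hμS : (⟨m, hmn⟩ : Fin n) ∉ T.erase b := fun h => hμT (mem_of_mem_erase h)
    have hbS : b ∉ T.erase b := notMem_erase _ _
    have ham : (a : ℕ) < m := hab.trans (hbc.trans hcμ)
    have hbm : (b : ℕ) < m := hlt b hbT
    have hpair : ∀ u v, u ≠ v → u ∉ T.erase b → v ∉ T.erase b → (u : ℕ) < m → (v : ℕ) < m →
        PowComparable (F (T.erase b ∪ {u, v})) (w (T.erase b ∪ {u, v})) := by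
      intro u v huv hu hv hum hvm
      refine hold _ ?_ ?_
      · have hd : Disjoint (T.erase b) {u, v} := by
          rw [disjoint_insert_right, disjoint_singleton_right]
          exact ⟨hu, hv⟩
        rw [card_union_of_disjoint hd, card_pair huv, hSc]
      · intro z hz
        rw [mem_union, mem_insert, mem_singleton] at hz
        rcases hz with hz | rfl | rfl
        · exact hSm z hz
        · exact hum
        · exact hvm
    have hrec : ∀ e, e ∉ T → (e : ℕ) < m → inner m (exch T b e) ⊂ inner m T →
        PowComparable (F (T.erase b ∪ {e, ⟨m, hmn⟩})) (w (T.erase b ∪ {e, ⟨m, hmn⟩})) := by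
      intro e he hem hss
      have := ihN _ (hN ▸ card_lt_card hss) (exch T b e) rfl
        (by rw [card_exch hbT he, hT]) (by
          intro z hz
          rcases mem_exch.mp hz with rfl | h
          · exact hem
          · exact hlt z h.2)
      rwa [insert_exch_eq] at this
    rw [insert_eq_erase_union _ hbT]
    -- The three-term relation for a < b < c < μ over S = T - b is solved for S+bμ. The minors on
    -- S+cμ and S+aμ have fewer inner elements, the others are old, and the right side is a sum of
    -- positive terms divided by the minor on S+ac.
    have hsum := ((hpair a b hab.ne haS hbS ham hbm).mul (hrec c hcT hcm hs2)).add
      ((hrec a haT ham hs1).mul (hpair b c hbc.ne hbS hcS hbm hcm))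
    rw [← hw _ a b c ⟨m, hmn⟩ hSc hab hbc hcμ haS hbS hcS hμS,
      add_comm (w (T.erase b ∪ {a, c}))] at hsum
    refine (hpair a c (hab.trans hbc).ne haS hcS ham hcm).of_mul hsum fun t _ _ => ?_
    rw [mul_comm]
    exact hF _ a b c ⟨m, hmn⟩ hSc hab hbc hcμ haS hbS hcS hμS t

/-- Every weight satisfying the tropical three-term relations is, up to bounded factors, the order
of vanishing of the maximal minors of a family of matrices. -/
theorem exists_family {n k : ℕ} (hk : 0 < k) (hkn : k ≤ n) {w : Finset (Fin n) → ℕ}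
    (hw : ∀ (S : Finset (Fin n)) (a b c d : Fin n), S.card + 2 = k → a < b → b < c → c < d →
        a ∉ S → b ∉ S → c ∉ S → d ∉ S →
        w (S ∪ {a, c}) + w (S ∪ {b, d}) =
          min (w (S ∪ {a, b}) + w (S ∪ {c, d})) (w (S ∪ {a, d}) + w (S ∪ {b, c}))) :
    ∃ A : ℝ → Matrix (Fin k) (Fin n) ℝ, ∀ I : Finset (Fin n), I.card = k →
      PowComparable (fun t => minor (A t) I) (w I) := by
  suffices H : ∀ m, k ≤ m → m ≤ n → ∃ A : ℝ → Matrix (Fin k) (Fin n) ℝ,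
      ∀ I : Finset (Fin n), I.card = k → (∀ x ∈ I, (x : ℕ) < m) →
      PowComparable (fun t => minor (A t) I) (w I) by
    obtain ⟨A, hA⟩ := H n hkn le_rfl
    exact ⟨A, fun I hI => hA I hI fun x _ => x.isLt⟩
  intro m hkm
  induction m, hkm using Nat.le_induction with
  | base =>
    intro _
    set I₀ : Finset (Fin n) := univ.filter fun x : Fin n => (x : ℕ) < k with hI₀
    have hI₀c : I₀.card = k := by rw [hI₀, Fin.card_filter_val_lt]; omega
    -- With k places only one minor matters; scaling one row of a matrix with positive minors gives
    -- it the order w I₀.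
    refine ⟨fun t => (vander k n).updateRow ⟨0, hk⟩ (t ^ w I₀ • (vander k n) ⟨0, hk⟩),
      fun I hI hlt => ?_⟩
    have : I = I₀ := eq_of_subset_of_card_le (fun x hx => by simp [hI₀, hlt x hx]) (by omega)
    subst this
    have hpos := minor_vander_pos hI₀c
    refine ⟨_, _, hpos, hpos, fun t _ _ => ?_⟩
    have h1 := minor_updateRow_smul (vander k n) ⟨0, hk⟩ (t ^ w I₀) I₀
    exact ⟨(h1.trans (mul_comm _ _)).ge, (h1.trans (mul_comm _ _)).le⟩
  | succ m hkm ih =>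
    intro hmn
    obtain ⟨A, hA⟩ := ih (by omega)
    obtain ⟨μ, hμ⟩ : ∃ μ : Fin n, μ = ⟨m, hmn⟩ := ⟨_, rfl⟩
    have hpos : ∀ t, 0 < t → t ≤ 1 → ∀ I : Finset (Fin n), I.card = k →
        (∀ x ∈ I, (x : ℕ) < m) → minor (A t) I ≠ 0 := by
      intro t h0 h1 I hI hlt
      obtain ⟨c, C, hc, hC, h⟩ := hA I hI hlt
      have : 0 < c * t ^ w I := by positivity
      exact (this.trans_le (h t h0 h1).1).ne'
    -- The column is prescribed only for t in (0, 1], where the old minors are known to be nonzero;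
    -- elsewhere any value serves, here 0.
    have hx : ∀ t, ∃ x : Fin k → ℝ, 0 < t → t ≤ 1 → ∀ p < k, minor ((A t).updateCol μ x)
        (insert μ (twoSegments n m p (k - 1 - p))) =
          t ^ w (insert μ (twoSegments n m p (k - 1 - p))) := by
      intro t
      by_cases ht : 0 < t ∧ t ≤ 1
      · obtain ⟨x, hx⟩ := exists_column hkm hmn (A t) (hpos t ht.1 ht.2)
          (fun p => t ^ w (insert μ (twoSegments n m p (k - 1 - p))))
        rw [← hμ] at hx
        exact ⟨x, fun _ _ => hx⟩
      · exact ⟨0, fun h0 h1 => absurd ⟨h0, h1⟩ ht⟩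
    choose x hx using hx
    refine ⟨fun t => (A t).updateCol μ (x t), ?_⟩
    have hold : ∀ I : Finset (Fin n), I.card = k → (∀ z ∈ I, (z : ℕ) < m) →
        PowComparable (fun t => minor ((A t).updateCol μ (x t)) I) (w I) := by
      intro I hI hlt
      have hμI : μ ∉ I := fun h => absurd (hlt μ h) (by simp [hμ])
      simp only [minor_updateCol_of_notMem _ hμI]
      exact hA I hI hlt
    have hnew := powComparable_insert hkm hmn hw
      (F := fun I t => minor ((A t).updateCol μ (x t)) I)
      (fun S a b c d hS hab hbc hcd ha hb hc hd t =>
        minor_three_term _ hS hab hbc hcd ha hb hc hd) hold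
    rw [← hμ] at hnew
    replace hnew := hnew fun p hp => ⟨1, 1, one_pos, one_pos, fun t h0 h1 => by
      have := hx t h0 h1 p hp
      rw [one_mul]
      exact ⟨this.ge, this.le⟩⟩
    intro I hI hlt
    by_cases hμI : μ ∈ I
    · have := hnew _ (I.erase μ) rfl (by rw [card_erase_add_one hμI, hI]) (by
        intro z hz
        have h1 := hlt z (mem_of_mem_erase hz)
        have h2 : (z : ℕ) ≠ m := fun e => ne_of_mem_erase hz (by rw [hμ]; exact Fin.ext e)
        omega)
      rwa [insert_erase hμI] at this
    · refine hold I hI fun z hz => ?_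
      have h1 := hlt z hz
      have h2 : (z : ℕ) ≠ m := fun e => hμI ((show z = μ by rw [hμ]; exact Fin.ext e) ▸ hz)
      omega

end PositroidChar

namespace PositroidChar

open Finset Filter Topology

/-! ### Passing to the limit -/

theorem minor_mul_left {n k : ℕ} (C : Matrix (Fin k) (Fin k) ℝ) (A : Matrix (Fin k) (Fin n) ℝ)
    (I : Finset (Fin n)) : minor (C * A) I = C.det * minor A I := by
  by_cases h : I.card = k
  · rw [minor_eq _ h, minor_eq _ h, colDet, colDet, ← Matrix.det_mul]
    congr 1
  · simp [minor, h]

/-- By Cramer's rule the entries of a matrix normalized to the identity on some columns are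
themselves minors up to sign, so a bound on the minors bounds the entries and gives compactness. -/
theorem entry_eq_colDet {n k : ℕ} (B : Matrix (Fin k) (Fin n) ℝ) {f : Fin k → Fin n}
    (hf : B.submatrix id f = 1) (r : Fin k) (j : Fin n) :
    B r j = colDet B (Function.update f r j) := by
  have h1 : B.submatrix id (Function.update f r j) =
      (1 : Matrix (Fin k) (Fin k) ℝ).updateCol r (fun i => B i j) := by
    rw [← hf]
    ext i s
    by_cases hs : s = r
    · subst hs; simp
    · simp [hs]
  rw [colDet, h1, ← Matrix.cramer_apply, Matrix.cramer_one]
  rfl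

theorem continuous_minor {n k : ℕ} (I : Finset (Fin n)) :
    Continuous fun B : Fin k → Fin n → ℝ => minor (Matrix.of B) I := by
  by_cases h : I.card = k
  · simp only [minor_eq _ h, colDet]
    refine Continuous.matrix_det ?_
    exact continuous_pi fun i => continuous_pi fun j =>
      (continuous_apply (I.orderEmbOfFin h j)).comp (continuous_apply i)
  · simp only [minor, h]
    exact continuous_const

/-- Normalizing by the block on I₀ divides all minors by one that stays between positive constants,
because w I₀ = 0. The normalized matrices are bounded, so a subsequence with t tending to 0
converges. Minors with w = 0 stay bounded away from 0, and those with w > 0 are squeezed to 0 by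
t^w. -/
theorem exists_limit_matrix {n k : ℕ} {w : Finset (Fin n) → ℕ}
    {A : ℝ → Matrix (Fin k) (Fin n) ℝ}
    (hA : ∀ I : Finset (Fin n), I.card = k → PowComparable (fun t => minor (A t) I) (w I))
    {I₀ : Finset (Fin n)} (hI₀ : I₀.card = k) (hw₀ : w I₀ = 0) :
    ∃ B : Matrix (Fin k) (Fin n) ℝ, ∀ I : Finset (Fin n), I.card = k →
      0 ≤ minor B I ∧ (minor B I ≠ 0 ↔ w I = 0) := by
  obtain ⟨c₀, C₀, hc₀, hC₀, h₀⟩ := hA I₀ hI₀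
  simp only [hw₀, pow_zero, mul_one] at h₀
  have hA' : ∀ I : Finset (Fin n), ∃ c C : ℝ, 0 < c ∧ 0 < C ∧ (I.card = k →
      ∀ t, 0 < t → t ≤ 1 → c * t ^ w I ≤ minor (A t) I ∧ minor (A t) I ≤ C * t ^ w I) := by
    intro I
    by_cases hI : I.card = k
    · obtain ⟨c, C, hc, hC, h⟩ := hA I hI
      exact ⟨c, C, hc, hC, fun _ => h⟩
    · exact ⟨1, 1, one_pos, one_pos, fun h => absurd h hI⟩
  choose c C hc hC h using hA'
  let f := I₀.orderEmbOfFin hI₀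
  let B : ℝ → Matrix (Fin k) (Fin n) ℝ := fun t => ((A t).submatrix id f)⁻¹ * A t
  have hdet : ∀ t, ((A t).submatrix id f).det = minor (A t) I₀ := fun t => (minor_eq _ hI₀).symm
  have hpos₀ : ∀ t, 0 < t → t ≤ 1 → 0 < minor (A t) I₀ := fun t h0 h1 =>
    hc₀.trans_le (h₀ t h0 h1).1
  have hBm : ∀ t, 0 < t → t ≤ 1 → ∀ I, minor (B t) I = minor (A t) I / minor (A t) I₀ := by
    intro t h0 h1 I
    rw [minor_mul_left, Matrix.det_nonsing_inv, hdet, Ring.inverse_eq_inv', div_eq_inv_mul]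
  have hlow : ∀ t, 0 < t → t ≤ 1 → ∀ I : Finset (Fin n), I.card = k →
      c I / C₀ * t ^ w I ≤ minor (B t) I := by
    intro t h0 h1 I hI
    rw [hBm t h0 h1, le_div_iff₀ (hpos₀ t h0 h1)]
    calc c I / C₀ * t ^ w I * minor (A t) I₀ ≤ c I / C₀ * t ^ w I * C₀ :=
          mul_le_mul_of_nonneg_left (h₀ t h0 h1).2
            (mul_nonneg (div_nonneg (hc I).le hC₀.le) (pow_nonneg h0.le _))
      _ = c I * t ^ w I := by field_simp
      _ ≤ _ := (h I hI t h0 h1).1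
  have hupp : ∀ t, 0 < t → t ≤ 1 → ∀ I : Finset (Fin n), I.card = k →
      minor (B t) I ≤ C I / c₀ * t ^ w I := by
    intro t h0 h1 I hI
    rw [hBm t h0 h1, div_le_iff₀ (hpos₀ t h0 h1)]
    calc minor (A t) I ≤ C I * t ^ w I := (h I hI t h0 h1).2
      _ = C I / c₀ * t ^ w I * c₀ := by field_simp
      _ ≤ C I / c₀ * t ^ w I * minor (A t) I₀ :=
          mul_le_mul_of_nonneg_left (h₀ t h0 h1).1
            (mul_nonneg (div_nonneg (hC I).le hc₀.le) (pow_nonneg h0.le _))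
  have hnn : ∀ t, 0 < t → t ≤ 1 → ∀ I : Finset (Fin n), I.card = k → 0 ≤ minor (B t) I :=
    fun t h0 h1 I hI => le_trans (mul_nonneg (div_nonneg (hc I).le hC₀.le) (pow_nonneg h0.le _))
      (hlow t h0 h1 I hI)
  set K : ℝ := ∑ I, C I / c₀ with hK
  have hKle : ∀ I, C I / c₀ ≤ K := fun I =>
    single_le_sum (f := fun I => C I / c₀) (fun I _ => div_nonneg (hC I).le hc₀.le) (mem_univ I)
  have hK0 : 0 ≤ K := sum_nonneg fun I _ => div_nonneg (hC I).le hc₀.le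
  have hentry : ∀ t, 0 < t → t ≤ 1 → ∀ r j, |B t r j| ≤ K := by
    intro t h0 h1 r j
    have hone : (B t).submatrix id f = 1 := by
      have : (B t).submatrix id f = ((A t).submatrix id f)⁻¹ * (A t).submatrix id f := rfl
      rw [this, Matrix.nonsing_inv_mul]
      rw [hdet]
      exact isUnit_iff_ne_zero.mpr (hpos₀ t h0 h1).ne'
    rw [entry_eq_colDet (B t) hone r j]
    by_cases hg : Function.Injective (Function.update f r j)
    · have hcard : (univ.image (Function.update f r j)).card = k := by
        rw [card_image_of_injective _ hg]; simp
      rw [abs_colDet hg rfl, abs_of_nonneg (hnn t h0 h1 _ hcard)]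
      refine (hupp t h0 h1 _ hcard).trans (le_trans ?_
        (hKle (univ.image (Function.update f r j))))
      exact mul_le_of_le_one_right (div_nonneg (hC _).le hc₀.le) (pow_le_one₀ h0.le h1)
    · rw [colDet_eq_zero _ hg, abs_zero]
      exact hK0
  let τ : ℕ → ℝ := fun N => 1 / ((N : ℝ) + 1)
  have hτ0 : ∀ N, 0 < τ N := fun N => by positivity
  have hτ1 : ∀ N, τ N ≤ 1 := fun N => by
    simp only [τ]
    rw [div_le_one (by positivity)]
    have : (0 : ℝ) ≤ N := by positivity
    linarith
  have hτ : Tendsto τ atTop (𝓝 0) := tendsto_one_div_add_atTop_nhds_zero_nat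
  have hcomp : IsCompact (Set.pi Set.univ fun _ : Fin k =>
      Set.pi Set.univ fun _ : Fin n => Set.Icc (-K) K) :=
    isCompact_univ_pi fun _ => isCompact_univ_pi fun _ => isCompact_Icc
  obtain ⟨B', -, φ, hφ, hlim⟩ := hcomp.tendsto_subseq
    (x := fun N : ℕ => (fun r j => B (τ N) r j : Fin k → Fin n → ℝ))
    (fun N r _ j _ => abs_le.mp (hentry _ (hτ0 N) (hτ1 N) r j))
  have hminor : ∀ I, Tendsto (fun N => minor (B (τ (φ N))) I) atTop
      (𝓝 (minor (Matrix.of B') I)) := fun I =>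
    ((continuous_minor I).tendsto B').comp hlim
  refine ⟨Matrix.of B', fun I hI => ?_⟩
  refine ⟨ge_of_tendsto' (hminor I) fun N => hnn _ (hτ0 _) (hτ1 _) I hI, fun hne => ?_,
    fun hwI => ?_⟩
  · by_contra hwI
    refine hne (tendsto_nhds_unique (hminor I) ?_)
    refine squeeze_zero (g := fun N => C I / c₀ * τ (φ N) ^ w I)
      (fun N => hnn _ (hτ0 _) (hτ1 _) I hI) (fun N => hupp _ (hτ0 _) (hτ1 _) I hI) ?_
    have h1 := ((hτ.comp hφ.tendsto_atTop).pow (w I)).const_mul (C I / c₀)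
    rw [zero_pow hwI, mul_zero] at h1
    exact h1
  · have h1 : c I / C₀ ≤ minor (Matrix.of B') I := by
      refine ge_of_tendsto' (hminor I) fun N => ?_
      have := hlow _ (hτ0 (φ N)) (hτ1 (φ N)) I hI
      rwa [hwI, pow_zero, mul_one] at this
    exact (lt_of_lt_of_le (div_pos (hc I) hC₀) h1).ne'

/-! ### Positroids are the matroids satisfying the positive three-term condition -/

theorem PosThreeTerm.isPositroid {n k : ℕ} {M : Matroid (Fin n)} (hE : M.E = Set.univ)
    (hk : M.eRank = k) (hM : PosThreeTerm M) : IsPositroid M := by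
  obtain ⟨w, hw1, hw2⟩ := hM.exists_weight hE hk
  obtain ⟨I₀, hI₀⟩ := M.exists_isBase
  lift I₀ to Finset (Fin n) using Set.toFinite I₀
  obtain ⟨hc, hw₀⟩ := (hw1 I₀).mp hI₀
  refine ⟨hE, k, ?_⟩
  -- Rank 0 is separate because `exists_family` needs a row to scale; the empty determinant is 1.
  rcases Nat.eq_zero_or_pos k with rfl | hkpos
  · have hdet : ∀ (I : Finset (Fin n)) (hI : I.card = 0),
        plucker (0 : Matrix (Fin 0) (Fin n) ℝ) I hI = 1 := fun I hI => Matrix.det_isEmpty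
    refine ⟨0, fun I hI => by rw [hdet]; exact zero_le_one, fun I => ⟨fun h => ?_, ?_⟩⟩
    · exact ⟨((hw1 I).mp h).1, by rw [hdet]; exact one_ne_zero⟩
    · rintro ⟨hI, -⟩
      rw [card_eq_zero] at hI hc
      rw [hI, ← hc]
      exact hI₀
  · have hkn : k ≤ n := by
      have := card_le_univ I₀
      rw [Fintype.card_fin] at this
      omega
    obtain ⟨A, hA⟩ := exists_family hkpos hkn hw2
    obtain ⟨B, hB⟩ := exists_limit_matrix hA hc hw₀
    have hpl : ∀ (I : Finset (Fin n)) (hI : I.card = k), plucker B I hI = minor B I :=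
      fun I hI => by simp [minor, hI]
    refine ⟨B, fun I hI => hpl I hI ▸ (hB I hI).1, fun I => ?_⟩
    rw [hw1 I]
    constructor
    · rintro ⟨hI, h⟩
      exact ⟨hI, by rw [hpl]; exact (hB I hI).2.mpr h⟩
    · rintro ⟨hI, h⟩
      rw [hpl] at h
      exact ⟨hI, (hB I hI).2.mp h⟩

theorem IsPositroid.posThreeTerm {n : ℕ} {M : Matroid (Fin n)} (hM : IsPositroid M) :
    PosThreeTerm M := by
  obtain ⟨-, k, A, hA, hbase⟩ := hM
  have hnn : ∀ I, 0 ≤ minor A I := fun I => by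
    unfold minor; split_ifs with h
    · exact hA I h
    · exact le_rfl
  have hb : ∀ I : Finset (Fin n), M.IsBase (I : Set (Fin n)) ↔ 0 < minor A I := by
    intro I
    rw [hbase, lt_iff_le_and_ne, and_iff_right (hnn I)]
    unfold minor
    split_ifs with h
    · simp [h, eq_comm]
    · simp [h]
  intro S a b c d hab hbc hcd ha hc hb' hd h
  have hS : S.card + 2 = k := by
    have key : ∀ x y, x ≠ y → x ∉ S → y ∉ S → M.IsBase (S ∪ {x, y} : Finset (Fin n)) →
        S.card + 2 = k := by
      intro x y hxy hx hy h
      obtain ⟨h1, -⟩ := (hbase _).mp h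
      rw [← h1, card_union_of_disjoint (by simp [hx, hy]), card_pair hxy]
    rcases h with h | h
    · exact key a b hab.ne ha hc h.1
    · exact key b c hbc.ne hc hb' h.2
  have h3 := minor_three_term A hS hab hbc hcd ha hc hb' hd
  simp only [hb] at h ⊢
  have hpos : 0 < minor A (S ∪ {a, c}) * minor A (S ∪ {b, d}) := by
    rw [h3]
    rcases h with h | h
    · exact add_pos_of_pos_of_nonneg (mul_pos h.1 h.2) (mul_nonneg (hnn _) (hnn _))
    · exact add_pos_of_nonneg_of_pos (mul_nonneg (hnn _) (hnn _)) (mul_pos h.1 h.2)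
  exact ⟨pos_of_mul_pos_left hpos (hnn _), pos_of_mul_pos_right hpos (hnn _)⟩

end PositroidChar

namespace PositroidChar

open Finset

/-! ### Polytopes with vertices among the indicator vectors -/

theorem indVec_apply {n : ℕ} (B : Set (Fin n)) (i : Fin n) [Decidable (i ∈ B)] :
    indVec B i = if i ∈ B then 1 else 0 := by
  by_cases h : i ∈ B <;> simp [indVec, h]

theorem indVec_injective {n : ℕ} : Function.Injective (indVec : Set (Fin n) → Fin n → ℝ) := by
  classical
  intro A B h
  ext i
  have := congrFun h i
  rw [indVec_apply, indVec_apply] at this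
  by_cases hA : i ∈ A <;> by_cases hB : i ∈ B <;> simp_all

/-- The hull lies in the unit cube, where a coordinate equal to 0 or 1 at an interior point of a
segment is constant along the segment. Hence a matroid polytope determines its bases. -/
theorem extremePoints_convexHull_indVec {n : ℕ} (𝓑 : Set (Set (Fin n))) :
    (convexHull ℝ (indVec '' 𝓑)).extremePoints ℝ = indVec '' 𝓑 := by
  classical
  refine Set.Subset.antisymm extremePoints_convexHull_subset ?_
  have hcube : convexHull ℝ (indVec '' 𝓑) ⊆ Set.Icc 0 1 := by
    refine convexHull_min ?_ (convex_Icc 0 1)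
    rintro _ ⟨B, -, rfl⟩
    constructor <;> intro i <;> rw [indVec_apply] <;> split_ifs <;> simp
  rintro _ ⟨B, hB, rfl⟩
  rw [mem_extremePoints_iff_left]
  refine ⟨subset_convexHull ℝ _ ⟨B, hB, rfl⟩, fun x hx y hy hxy => ?_⟩
  obtain ⟨a, b, ha, hb, hab, h⟩ := hxy
  ext i
  have hi := congrFun h i
  have hx0 : 0 ≤ x i := (hcube hx).1 i
  have hx1 : x i ≤ 1 := (hcube hx).2 i
  have hy0 : 0 ≤ y i := (hcube hy).1 i
  have hy1 : y i ≤ 1 := (hcube hy).2 i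
  simp only [Pi.add_apply, Pi.smul_apply, smul_eq_mul] at hi
  rw [indVec_apply] at hi ⊢
  split_ifs at hi ⊢
  · have h1 : b * y i ≤ b * 1 := mul_le_mul_of_nonneg_left hy1 hb.le
    have h2 : a * 1 ≤ a * x i := by linarith
    exact le_antisymm hx1 (le_of_mul_le_mul_left h2 ha)
  · have h1 : 0 ≤ b * y i := mul_nonneg hb.le hy0
    have h2 : a * x i ≤ a * 0 := by linarith
    exact le_antisymm (le_of_mul_le_mul_left h2 ha) hx0

/-- The points that lie in the hull of the maximizing vertices or strictly below the maximum form a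
convex set containing V, hence containing the whole hull. -/
theorem exposed_convexHull {E : Type*} [AddCommGroup E] [Module ℝ E] [TopologicalSpace E]
    {V : Set E} (hV : V.Finite) (l : StrongDual ℝ E) :
    {x ∈ convexHull ℝ V | ∀ y ∈ convexHull ℝ V, l y ≤ l x} =
      convexHull ℝ {v ∈ V | ∀ u ∈ V, l u ≤ l v} := by
  rcases V.eq_empty_or_nonempty with rfl | hne
  · simp
  obtain ⟨v₀, hv₀, hmax⟩ := hV.exists_maximalFor l V hne
  replace hmax : ∀ u ∈ V, l u ≤ l v₀ := fun u hu => by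
    by_contra h
    exact h (hmax hu (not_le.mp h).le)
  have hle : ∀ y ∈ convexHull ℝ V, l y ≤ l v₀ := fun y hy =>
    convexHull_min (t := {y | l y ≤ l v₀}) hmax
      (convex_halfSpace_le l.toLinearMap.isLinear _) hy
  set W := {v ∈ V | ∀ u ∈ V, l u ≤ l v} with hW
  have hWV : W ⊆ V := fun v hv => hv.1
  have hWl : ∀ v ∈ W, l v = l v₀ := fun v hv => le_antisymm (hmax v hv.1) (hv.2 v₀ hv₀)
  apply Set.Subset.antisymm
  · rintro x ⟨hx, hxm⟩
    have hconv : Convex ℝ {x | x ∈ convexHull ℝ W ∨ l x < l v₀} := by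
      have hleC : ∀ x, x ∈ convexHull ℝ W ∨ l x < l v₀ → l x ≤ l v₀ := fun x hx =>
        hx.elim (fun h => hle x (convexHull_mono hWV h)) le_of_lt
      rw [convex_iff_forall_pos]
      intro x hx y hy a b ha hb hab
      by_cases hxy : x ∈ convexHull ℝ W ∧ y ∈ convexHull ℝ W
      · exact Or.inl (convex_convexHull ℝ W hxy.1 hxy.2 ha.le hb.le hab)
      · right
        rw [map_add, map_smul, map_smul, smul_eq_mul, smul_eq_mul]
        have e : l v₀ = a * l v₀ + b * l v₀ := by rw [← add_mul, hab, one_mul]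
        rw [e]
        rw [not_and_or] at hxy
        rcases hxy with h | h
        · exact add_lt_add_of_lt_of_le (mul_lt_mul_of_pos_left (hx.resolve_left h) ha)
            (mul_le_mul_of_nonneg_left (hleC y hy) hb.le)
        · exact add_lt_add_of_le_of_lt (mul_le_mul_of_nonneg_left (hleC x hx) ha.le)
            (mul_lt_mul_of_pos_left (hy.resolve_left h) hb)
    have hsub : V ⊆ {x | x ∈ convexHull ℝ W ∨ l x < l v₀} := by
      intro v hv
      rcases (hmax v hv).eq_or_lt with h | h
      · exact Or.inl (subset_convexHull ℝ W ⟨hv, fun u hu => h ▸ hmax u hu⟩)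
      · exact Or.inr h
    refine (convexHull_min hsub hconv hx).resolve_right (not_lt.mpr ?_)
    exact hxm v₀ (subset_convexHull ℝ V hv₀)
  · intro x hx
    refine ⟨convexHull_mono hWV hx, fun y hy => (hle y hy).trans ?_⟩
    exact convexHull_min (t := {y | l v₀ ≤ l y}) (fun v hv => (hWl v hv).ge)
      (convex_halfSpace_ge l.toLinearMap.isLinear _) hx

theorem matroid_eq_of_polytope_eq {n : ℕ} {M N : Matroid (Fin n)} (hM : M.E = Set.univ)
    (hN : N.E = Set.univ) (h : matroidPolytope M = matroidPolytope N) : M = N := by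
  refine Matroid.ext_isBase (hM.trans hN.symm) fun B _ => ?_
  have h1 : indVec '' {B | M.IsBase B} = indVec '' {B | N.IsBase B} :=
    (extremePoints_convexHull_indVec _).symm.trans
      ((congrArg (Set.extremePoints ℝ) h).trans (extremePoints_convexHull_indVec _))
  have h2 := indVec_injective.image_injective h1
  exact Set.ext_iff.mp h2 B

/-! ### Faces of matroid polytopes -/

theorem indVec_exchange {n : ℕ} {A B : Set (Fin n)} {x y : Fin n} (hxA : x ∈ A) (hxB : x ∉ B)
    (hyB : y ∈ B) (hyA : y ∉ A) :
    indVec (insert y (A \ {x})) + indVec (insert x (B \ {y})) = indVec A + indVec B := by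
  classical
  have hxy : x ≠ y := fun h => hxB (h ▸ hyB)
  ext i
  simp only [Pi.add_apply, indVec_apply, Set.mem_insert_iff, Set.mem_sdiff, Set.mem_singleton_iff]
  by_cases h1 : i = x
  · subst h1; simp [hxA, hxB, hxy]
  · by_cases h2 : i = y
    · subst h2; simp [hyA, hyB, h1]
    · simp [h1, h2]

/-- The matroid whose bases are the bases of `M` on which `l` is maximal. -/
def faceMatroid {n : ℕ} (M : Matroid (Fin n)) (l : StrongDual ℝ (Fin n → ℝ)) :
    Matroid (Fin n) :=
  Matroid.ofIsBaseOfFinite (E := Set.univ) Set.finite_univ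
    (fun B => M.IsBase B ∧ ∀ B', M.IsBase B' → l (indVec B') ≤ l (indVec B))
    (by
      have hne : {B | M.IsBase B}.Nonempty := M.exists_isBase
      obtain ⟨B, hB, hmax⟩ := (Set.toFinite {B | M.IsBase B}).exists_maximalFor
        (fun B => l (indVec B)) _ hne
      refine ⟨B, hB, fun B' hB' => ?_⟩
      by_contra h
      exact h (hmax hB' (not_le.mp h).le))
    (by
      rintro A B ⟨hA, hAm⟩ ⟨hB, hBm⟩ x ⟨hxA, hxB⟩
      -- Symmetric exchange preserves the sum of the two indicator vectors, so when A and B are both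
      -- maximal the two new bases must be maximal as well.
      obtain ⟨y, hyB, hyA, h1, h2⟩ := IsBase.symm_exchange hA hB hxA hxB
      refine ⟨y, ⟨hyB, hyA⟩, h1, fun B' hB' => (hAm B' hB').trans ?_⟩
      have h3 := congrArg l (indVec_exchange hxA hxB hyB hyA)
      rw [map_add, map_add] at h3
      have h4 := hBm _ h2
      linarith)
    (fun _ _ => Set.subset_univ _)

theorem faceMatroid_isBase {n : ℕ} (M : Matroid (Fin n)) (l : StrongDual ℝ (Fin n → ℝ))
    (B : Set (Fin n)) : (faceMatroid M l).IsBase B ↔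
      M.IsBase B ∧ ∀ B', M.IsBase B' → l (indVec B') ≤ l (indVec B) := by
  unfold faceMatroid
  exact Iff.rfl

theorem exposed_matroidPolytope {n : ℕ} (M : Matroid (Fin n)) (l : StrongDual ℝ (Fin n → ℝ)) :
    {x ∈ matroidPolytope M | ∀ y ∈ matroidPolytope M, l y ≤ l x} =
      matroidPolytope (faceMatroid M l) := by
  rw [matroidPolytope, exposed_convexHull (Set.toFinite _), matroidPolytope]
  congr 1
  ext v
  constructor
  · rintro ⟨⟨B, hB, rfl⟩, h⟩
    exact ⟨B, (faceMatroid_isBase M l B).mpr ⟨hB, fun B' hB' => h _ ⟨B', hB', rfl⟩⟩, rfl⟩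
  · rintro ⟨B, hB, rfl⟩
    obtain ⟨h1, h2⟩ := (faceMatroid_isBase M l B).mp hB
    refine ⟨⟨B, h1, rfl⟩, ?_⟩
    rintro _ ⟨B', hB', rfl⟩
    exact h2 B' hB'

theorem indVec_pairs {n : ℕ} (S : Finset (Fin n)) {a b c d : Fin n} (ha : a ∉ S) (hb : b ∉ S)
    (hc : c ∉ S) (hd : d ∉ S) (hab : a ≠ b) (hcd : c ≠ d) (hac : a ≠ c) (hbd : b ≠ d) :
    indVec ((S ∪ {a, b} : Finset (Fin n)) : Set (Fin n)) +
        indVec ((S ∪ {c, d} : Finset (Fin n)) : Set (Fin n)) =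
      indVec ((S ∪ {a, c} : Finset (Fin n)) : Set (Fin n)) +
        indVec ((S ∪ {b, d} : Finset (Fin n)) : Set (Fin n)) := by
  have key : ∀ x y : Fin n, x ≠ y → x ∉ S → y ∉ S → ∀ i,
      indVec ((S ∪ {x, y} : Finset (Fin n)) : Set (Fin n)) i =
        (if i ∈ S then 1 else 0) + (if i = x then 1 else 0) + (if i = y then 1 else 0) := by
    intro x y hxy hx hy i
    rw [indVec_apply]
    simp only [mem_coe, mem_union, mem_insert, mem_singleton]
    by_cases h1 : i = x
    · subst h1; simp [hx, hxy]
    · by_cases h2 : i = y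
      · subst h2; simp [hy, h1]
      · simp [h1, h2]
  ext i
  simp only [Pi.add_apply, key a b hab ha hb, key c d hcd hc hd, key a c hac ha hc,
    key b d hbd hb hd]
  ring

/-- Opposite sides and diagonals have the same sum of indicator vectors, so if l is maximal at both
sides it is maximal at both diagonals, which are bases by hypothesis. -/
theorem PosThreeTerm.faceMatroid {n : ℕ} {M : Matroid (Fin n)} (hM : PosThreeTerm M)
    (l : StrongDual ℝ (Fin n → ℝ)) : PosThreeTerm (faceMatroid M l) := by
  intro S a b c d hab hbc hcd ha hb hc hd h
  have hac := hab.trans hbc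
  have hbd := hbc.trans hcd
  have had := hab.trans hbd
  simp only [faceMatroid_isBase] at h ⊢
  obtain ⟨h1, h2⟩ := hM S a b c d hab hbc hcd ha hb hc hd
    (h.imp (fun h => ⟨h.1.1, h.2.1⟩) (fun h => ⟨h.1.1, h.2.1⟩))
  have key : ∀ {A B C D : Set (Fin n)}, indVec A + indVec B = indVec C + indVec D →
      (M.IsBase A ∧ ∀ B', M.IsBase B' → l (indVec B') ≤ l (indVec A)) →
      (M.IsBase B ∧ ∀ B', M.IsBase B' → l (indVec B') ≤ l (indVec B)) →
      M.IsBase C → M.IsBase D →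
      (M.IsBase C ∧ ∀ B', M.IsBase B' → l (indVec B') ≤ l (indVec C)) ∧
      (M.IsBase D ∧ ∀ B', M.IsBase B' → l (indVec B') ≤ l (indVec D)) := by
    intro A B C D he hA hB hC hD
    have h3 := congrArg l he
    rw [map_add, map_add] at h3
    have h4 := hA.2 C hC
    have h5 := hB.2 D hD
    have h6 := hA.2 D hD
    have h7 := hB.2 C hC
    refine ⟨⟨hC, fun B' hB' => ?_⟩, ⟨hD, fun B' hB' => ?_⟩⟩
    · have := hA.2 B' hB'
      linarith
    · have := hB.2 B' hB'
      linarith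
  rcases h with ⟨hA, hB⟩ | ⟨hA, hB⟩
  · exact key (indVec_pairs S ha hb hc hd hab.ne hcd.ne hac.ne hbd.ne) hA hB h1 h2
  · have := indVec_pairs S ha hd hc hb had.ne hbc.ne' hac.ne hbd.ne'
    rw [pair_comm c b, pair_comm d b] at this
    exact key this hA hB h1 h2

theorem isPositroid_of_posThreeTerm {n : ℕ} {M : Matroid (Fin n)} (hE : M.E = Set.univ)
    (hM : PosThreeTerm M) : IsPositroid M := by
  obtain ⟨B, hB⟩ := M.exists_isBase
  lift B to Finset (Fin n) using Set.toFinite B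
  refine hM.isPositroid (k := B.card) hE ?_
  rw [← hB.encard_eq_eRank, Set.encard_coe_eq_coe_finsetCard]

theorem IsPositroid.exposed {n : ℕ} {M : Matroid (Fin n)} (hM : IsPositroid M)
    {F : Set (Fin n → ℝ)} (hne : F.Nonempty) (hF : IsExposed ℝ (matroidPolytope M) F) :
    IsPositroidPolytope F := by
  obtain ⟨l, rfl⟩ := hF hne
  refine ⟨faceMatroid M l, isPositroid_of_posThreeTerm rfl (hM.posThreeTerm.faceMatroid l), ?_⟩
  exact exposed_matroidPolytope M l

/-! ### The square face -/

/-- The indicator vectors of `S ∪ {a, b}`, `S ∪ {a, d}`, `S ∪ {b, c}` and `S ∪ {c, d}`. -/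
def squareVerts {n : ℕ} (S : Finset (Fin n)) (a b c d : Fin n) : Set (Fin n → ℝ) :=
  {indVec (↑S ∪ {a, b}), indVec (↑S ∪ {a, d}), indVec (↑S ∪ {b, c}), indVec (↑S ∪ {c, d})}

theorem squareVerts_eq_image {n : ℕ} (S : Finset (Fin n)) (a b c d : Fin n) :
    squareVerts S a b c d = indVec '' {(↑(S ∪ {a, b}) : Set (Fin n)), ↑(S ∪ {a, d}),
      ↑(S ∪ {b, c}), ↑(S ∪ {c, d})} := by
  simp only [Set.image_insert_eq, Set.image_singleton, coe_union, coe_insert, coe_singleton]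
  rfl

/-- The rotation reduces a missing diagonal S+bd to the case of a missing diagonal S+ac. -/
theorem squareVerts_rotate {n : ℕ} (S : Finset (Fin n)) (a b c d : Fin n) :
    squareVerts S b c d a = squareVerts S a b c d := by
  unfold squareVerts
  rw [Set.pair_comm b a, Set.pair_comm d a]
  ext v
  simp only [Set.mem_insert_iff, Set.mem_singleton_iff]
  tauto

theorem extremePoints_square {n : ℕ} (S : Finset (Fin n)) (a b c d : Fin n) :
    (convexHull ℝ (squareVerts S a b c d)).extremePoints ℝ = squareVerts S a b c d := by
  rw [squareVerts_eq_image, extremePoints_convexHull_indVec]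

/-- The four points form a parallelogram with independent edge vectors e_d - e_b and e_c - e_a. -/
theorem finrank_square {n : ℕ} {S : Finset (Fin n)} {a b c d : Fin n} (ha : a ∉ S) (hb : b ∉ S)
    (hc : c ∉ S) (hd : d ∉ S) (hab : a ≠ b) (hac : a ≠ c) (had : a ≠ d) (hbc : b ≠ c)
    (hbd : b ≠ d) (hcd : c ≠ d) :
    Module.finrank ℝ (vectorSpan ℝ (convexHull ℝ (squareVerts S a b c d))) = 2 := by
  classical
  rw [← direction_affineSpan, affineSpan_convexHull, direction_affineSpan]
  set P := indVec ((S : Set (Fin n)) ∪ {a, b}) with hP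
  set u := indVec ((S : Set (Fin n)) ∪ {a, d}) - P with hu
  set v := indVec ((S : Set (Fin n)) ∪ {b, c}) - P with hv
  have hsum : indVec ((S : Set (Fin n)) ∪ {c, d}) - P = u + v := by
    have := indVec_pairs S ha hb hd hc hab hcd.symm had hbc
    simp only [coe_union, coe_insert, coe_singleton, Set.pair_comm d c] at this
    rw [hu, hv, hP, sub_eq_iff_eq_add]
    linear_combination this
  have hspan : vectorSpan ℝ (squareVerts S a b c d) = Submodule.span ℝ (Set.range ![u, v]) := by
    have hmem : P ∈ squareVerts S a b c d := Or.inl rfl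
    rw [vectorSpan_eq_span_vsub_set_right ℝ hmem]
    simp only [squareVerts, Set.image_insert_eq, Set.image_singleton, vsub_eq_sub]
    rw [← hP, ← hu, ← hv, hsum, sub_self, Matrix.range_cons, Matrix.range_cons,
      Matrix.range_empty, Set.union_empty]
    apply le_antisymm
    · rw [Submodule.span_le]
      have h1 : u ∈ Submodule.span ℝ ({u} ∪ {v} : Set (Fin n → ℝ)) :=
        Submodule.subset_span (by simp)
      have h2 : v ∈ Submodule.span ℝ ({u} ∪ {v} : Set (Fin n → ℝ)) :=
        Submodule.subset_span (by simp)
      rintro z (rfl | rfl | rfl | rfl)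
      · exact Submodule.zero_mem _
      · exact h1
      · exact h2
      · exact Submodule.add_mem _ h1 h2
    · refine Submodule.span_mono ?_
      rintro z (rfl | rfl) <;> simp
  have hli : LinearIndependent ℝ ![u, v] := by
    rw [LinearIndependent.pair_iff]
    intro s t hst
    have h1 := congrFun hst a
    have h2 := congrFun hst b
    simp only [hu, hv, hP, Pi.add_apply, Pi.smul_apply, Pi.sub_apply, indVec_apply, Pi.zero_apply,
      smul_eq_mul] at h1 h2
    simp [ha, hb, hab, hac, had, hbc, hbd, hab.symm] at h1 h2
    exact ⟨h2, h1⟩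
  rw [hspan, finrank_span_eq_card hli]
  simp

/-- The functional used to expose the square face. -/
noncomputable def squareWeight {n : ℕ} (S : Finset (Fin n)) (a b c d : Fin n) (i : Fin n) : ℕ :=
  (if i ∈ S then 3 else 0) + (if i = a then 2 else 0) + (if i = c then 2 else 0) +
    (if i = b then 1 else 0) + (if i = d then 1 else 0)

theorem sum_squareWeight {n : ℕ} (S B : Finset (Fin n)) (a b c d : Fin n) :
    ∑ i ∈ B, squareWeight S a b c d i = 3 * (B ∩ S).card + (if a ∈ B then 2 else 0) +
      (if c ∈ B then 2 else 0) + (if b ∈ B then 1 else 0) + (if d ∈ B then 1 else 0) := by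
  simp only [squareWeight, sum_add_distrib, sum_ite_eq', sum_ite_mem, sum_const, smul_eq_mul,
    mul_comm]

theorem exists_dual_apply_indVec {n : ℕ} (f : Fin n → ℕ) :
    ∃ l : StrongDual ℝ (Fin n → ℝ), ∀ B : Finset (Fin n),
      l (indVec (B : Set (Fin n))) = ((∑ i ∈ B, f i : ℕ) : ℝ) := by
  refine ⟨∑ i, (f i : ℝ) • ContinuousLinearMap.proj (R := ℝ) (φ := fun _ : Fin n => ℝ) i,
    fun B => ?_⟩
  simp only [FunLike.coe_sum, FunLike.coe_smul, Finset.sum_apply,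
    Pi.smul_apply, ContinuousLinearMap.proj_apply, indVec_apply, mem_coe, smul_eq_mul, mul_ite,
    mul_one, mul_zero]
  rw [sum_ite_mem]
  simp

/-- The weights are 3 on S, 2 on a and c, 1 on b and d, and 0 elsewhere. Among sets of size |S| + 2,
only S+ac, which is not a base, reaches 3|S| + 4, and exactly the four sides reach 3|S| + 3: trading
an element of S for a third one of a, b, c, d gives at most 3|S| + 2. Nothing needs to be known
about S+bd. -/
theorem square_isTwoFace {n k : ℕ} {M : Matroid (Fin n)} (hk : M.eRank = k) {S : Finset (Fin n)}
    {a b c d : Fin n} (ha : a ∉ S) (hb : b ∉ S)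
    (hc : c ∉ S) (hd : d ∉ S) (hab : a ≠ b) (hac : a ≠ c) (had : a ≠ d) (hbc : b ≠ c)
    (hbd : b ≠ d) (hcd : c ≠ d)
    (h1 : M.IsBase (S ∪ {a, b} : Finset (Fin n))) (h2 : M.IsBase (S ∪ {a, d} : Finset (Fin n)))
    (h3 : M.IsBase (S ∪ {b, c} : Finset (Fin n))) (h4 : M.IsBase (S ∪ {c, d} : Finset (Fin n)))
    (h5 : ¬ M.IsBase (S ∪ {a, c} : Finset (Fin n))) :
    IsTwoFace (matroidPolytope M) (convexHull ℝ (squareVerts S a b c d)) := by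
  refine ⟨⟨_, subset_convexHull ℝ _ (Or.inl rfl)⟩, fun _ => ?_,
    finrank_square ha hb hc hd hab hac had hbc hbd hcd⟩
  have hcard : ∀ B : Finset (Fin n), M.IsBase (B : Set (Fin n)) → B.card = k := by
    intro B hB
    have := hB.encard_eq_eRank
    rw [hk, Set.encard_coe_eq_coe_finsetCard] at this
    exact_mod_cast this
  have hpc : ∀ x y, x ≠ y → x ∉ S → y ∉ S → (S ∪ {x, y}).card = S.card + 2 := by
    intro x y hxy hx hy
    rw [card_union_of_disjoint (by simp [hx, hy]), card_pair hxy]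
  have hSk : S.card + 2 = k := by rw [← hpc a b hab ha hb, hcard _ h1]
  obtain ⟨l, hl⟩ := exists_dual_apply_indVec (squareWeight S a b c d)
  -- the weight of the four vertices
  have hval : ∀ x y, (x = a ∨ x = c) → (y = b ∨ y = d) →
      ∑ i ∈ S ∪ {x, y}, squareWeight S a b c d i = 3 * S.card + 3 := by
    intro x y hx hy
    rw [sum_squareWeight, inter_eq_right.mpr subset_union_left]
    rcases hx with rfl | rfl <;> rcases hy with rfl | rfl <;>
      simp [ha, hb, hc, hd, hab, hac, had, hbc, hbd, hcd, hab.symm, hac.symm, had.symm, hbc.symm,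
        hbd.symm, hcd.symm]
  have hmain : ∀ B : Finset (Fin n), M.IsBase (B : Set (Fin n)) →
      ∑ i ∈ B, squareWeight S a b c d i ≤ 3 * S.card + 3 ∧
      (∑ i ∈ B, squareWeight S a b c d i = 3 * S.card + 3 →
        B = S ∪ {a, b} ∨ B = S ∪ {a, d} ∨ B = S ∪ {b, c} ∨ B = S ∪ {c, d}) := by
    intro B hB
    have hBk := hcard B hB
    rw [sum_squareWeight]
    have hs : (B ∩ S).card ≤ S.card := card_le_card inter_subset_right
    have hsum : (B ∩ S).card + (B ∩ {a, b, c, d}).card ≤ B.card := by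
      rw [← card_union_of_disjoint]
      · exact card_le_card (union_subset inter_subset_left inter_subset_left)
      · rw [disjoint_left]
        intro z hz hz'
        simp only [mem_inter, mem_insert, mem_singleton] at hz hz'
        rcases hz'.2 with rfl | rfl | rfl | rfl
        · exact ha hz.2
        · exact hb hz.2
        · exact hc hz.2
        · exact hd hz.2
    have hquad : (B ∩ {a, b, c, d}).card = (if a ∈ B then 1 else 0) + (if b ∈ B then 1 else 0) +
        (if c ∈ B then 1 else 0) + (if d ∈ B then 1 else 0) := by
      rw [inter_comm, ← filter_mem_eq_inter, card_filter,
        sum_insert (by simp [hab, hac, had]), sum_insert (by simp [hbc, hbd]),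
        sum_insert (by simp [hcd]), sum_singleton]
      ring
    have hfull : (B ∩ S).card = S.card → S ⊆ B := fun h =>
      inter_eq_right.mp (eq_of_subset_of_card_le inter_subset_right h.ge)
    have heq : ∀ x y, x ≠ y → x ∉ S → y ∉ S → (B ∩ S).card = S.card → x ∈ B → y ∈ B →
        B = S ∪ {x, y} := by
      intro x y hxy hx hy h hxB hyB
      refine (eq_of_subset_of_card_le (union_subset (hfull h) ?_) ?_).symm
      · intro z hz
        rcases mem_insert.mp hz with rfl | hz
        · exact hxB
        · exact mem_singleton.mp hz ▸ hyB
      · rw [hpc x y hxy hx hy, hBk, hSk]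
    have hnac : (B ∩ S).card = S.card → a ∈ B → c ∈ B → False := fun h hxa hxc =>
      h5 (heq a c hac ha hc h hxa hxc ▸ hB)
    by_cases hsf : (B ∩ S).card = S.card
    · have hn := hnac hsf
      by_cases hA : a ∈ B
      · have hC : c ∉ B := hn hA
        by_cases hB' : b ∈ B
        · have e := heq a b hab ha hb hsf hA hB'
          simp only [hA, hB', hC, if_true, if_false] at hquad ⊢
          refine ⟨?_, fun _ => Or.inl e⟩
          split_ifs at hquad ⊢ <;> omega
        · by_cases hD : d ∈ B
          · have e := heq a d had ha hd hsf hA hD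
            simp only [hA, hB', hC, hD, if_true, if_false]
            exact ⟨by omega, fun _ => Or.inr (Or.inl e)⟩
          · simp only [hA, hB', hC, hD, if_true, if_false]
            exact ⟨by omega, fun _ => by omega⟩
      · by_cases hC : c ∈ B
        · by_cases hB' : b ∈ B
          · have e := heq b c hbc hb hc hsf hB' hC
            simp only [hA, hB', hC, if_true, if_false] at hquad ⊢
            refine ⟨?_, fun _ => Or.inr (Or.inr (Or.inl e))⟩
            split_ifs at hquad ⊢ <;> omega
          · by_cases hD : d ∈ B
            · have e := heq c d hcd hc hd hsf hC hD
              simp only [hA, hB', hC, hD, if_true, if_false]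
              exact ⟨by omega, fun _ => Or.inr (Or.inr (Or.inr e))⟩
            · simp only [hA, hB', hC, hD, if_true, if_false]
              exact ⟨by omega, fun _ => by omega⟩
        · simp only [hA, hC, if_false]
          refine ⟨?_, fun h => absurd h ?_⟩ <;> split_ifs <;> omega
    · refine ⟨?_, fun h => absurd h ?_⟩ <;> split_ifs at hquad ⊢ <;> omega
  refine ⟨l, ?_⟩
  rw [exposed_matroidPolytope, matroidPolytope, squareVerts_eq_image]
  congr 2
  ext B
  lift B to Finset (Fin n) using Set.toFinite B
  simp only [Set.mem_insert_iff, Set.mem_singleton_iff, coe_inj]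
  change _ ↔ (faceMatroid M l).IsBase (B : Set (Fin n))
  rw [faceMatroid_isBase]
  have hle : ∀ B' : Set (Fin n), M.IsBase B' → l (indVec B') ≤ ((3 * S.card + 3 : ℕ) : ℝ) := by
    intro B' hB'
    lift B' to Finset (Fin n) using Set.toFinite B'
    rw [hl]
    exact_mod_cast (hmain B' hB').1
  have hvert : ∀ x y, (x = a ∨ x = c) → (y = b ∨ y = d) →
      l (indVec ((S ∪ {x, y} : Finset (Fin n)) : Set (Fin n))) = ((3 * S.card + 3 : ℕ) : ℝ) := by
    intro x y hx hy
    rw [hl, hval x y hx hy]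
  constructor
  · rintro (rfl | rfl | rfl | rfl)
    · exact ⟨h1, fun B' hB' => (hle B' hB').trans
        (hvert a b (Or.inl rfl) (Or.inl rfl)).ge⟩
    · exact ⟨h2, fun B' hB' => (hle B' hB').trans
        (hvert a d (Or.inl rfl) (Or.inr rfl)).ge⟩
    · refine ⟨h3, fun B' hB' => (hle B' hB').trans ?_⟩
      rw [pair_comm]
      exact (hvert c b (Or.inr rfl) (Or.inl rfl)).ge
    · exact ⟨h4, fun B' hB' => (hle B' hB').trans
        (hvert c d (Or.inr rfl) (Or.inr rfl)).ge⟩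
  · rintro ⟨hB, hmax⟩
    refine (hmain B hB).2 (le_antisymm (hmain B hB).1 ?_)
    have := hmax _ h1
    rw [hvert a b (Or.inl rfl) (Or.inl rfl), hl] at this
    exact_mod_cast this

/-- A matroid violating the positive three-term condition has a square face. -/
theorem exists_square_face {n k : ℕ} {M : Matroid (Fin n)} (hk : M.eRank = k)
    (hM : ¬ PosThreeTerm M) :
    ∃ (a b c d : Fin n) (S : Finset (Fin n)), a < b ∧ b < c ∧ c < d ∧
      a ∉ S ∧ b ∉ S ∧ c ∉ S ∧ d ∉ S ∧ S.card + 2 = k ∧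
      IsTwoFace (matroidPolytope M) (convexHull ℝ (squareVerts S a b c d)) := by
  unfold PosThreeTerm at hM
  push Not at hM
  obtain ⟨S, a, b, c, d, hab, hbc, hcd, ha, hb, hc, hd, hor, hnot⟩ := hM
  have hac := hab.trans hbc
  have hbd := hbc.trans hcd
  have had := hab.trans hbd
  have hnot' : ¬ (M.IsBase (S ∪ {a, c} : Finset (Fin n)) ∧
      M.IsBase (S ∪ {b, d} : Finset (Fin n))) := fun h => hnot h.1 h.2
  have hex : ∀ x y z, x ∉ S → x ≠ y → exch (S ∪ {x, y}) x z = S ∪ {z, y} := by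
    intro x y z hx hxy
    ext t
    simp only [mem_exch, mem_union, mem_insert, mem_singleton]
    by_cases htx : t = x
    · subst htx; simp [hx, hxy]
    · simp [htx]; tauto
  -- all four sides of the square are bases
  have hall : (M.IsBase (S ∪ {a, b} : Finset (Fin n)) ∧ M.IsBase (S ∪ {c, d} : Finset (Fin n))) ∧
      (M.IsBase (S ∪ {a, d} : Finset (Fin n)) ∧ M.IsBase (S ∪ {b, c} : Finset (Fin n))) := by
    rcases hor with h | h
    · refine ⟨h, ?_⟩
      -- Exchanging a from S+ab against S+cd gives either the other two sides or both diagonals; the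
      -- latter is excluded.
      obtain ⟨y, hy, hyI, e1, e2⟩ := isBase_symm_exch h.1 h.2 (x := a) (by simp)
        (by simp [ha, hac.ne, had.ne])
      have hyS : y ∉ S := fun h => hyI (by simp [h])
      simp only [mem_union, hyS, false_or, mem_insert, mem_singleton] at hy
      rw [hex a b y ha hab.ne] at e1
      rcases hy with rfl | rfl
      · rw [hex y d a hc hcd.ne] at e2
        rw [pair_comm y b] at e1
        exact ⟨e2, e1⟩
      · rw [pair_comm c y, hex y c a hd hcd.ne'] at e2
        rw [pair_comm y b] at e1
        exact absurd ⟨e2, e1⟩ hnot'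
    · refine ⟨?_, h⟩
      obtain ⟨y, hy, hyI, e1, e2⟩ := isBase_symm_exch h.1 h.2 (x := a) (by simp)
        (by simp [ha, hab.ne, hac.ne])
      have hyS : y ∉ S := fun h => hyI (by simp [h])
      simp only [mem_union, hyS, false_or, mem_insert, mem_singleton] at hy
      rw [hex a d y ha had.ne] at e1
      rcases hy with rfl | rfl
      · rw [hex y c a hb hbc.ne] at e2
        exact absurd ⟨e2, e1⟩ hnot'
      · rw [pair_comm b y, hex y b a hc hbc.ne'] at e2
        exact ⟨e2, e1⟩
  obtain ⟨⟨h1, h4⟩, h2, h3⟩ := hall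
  refine ⟨a, b, c, d, S, hab, hbc, hcd, ha, hb, hc, hd, ?_, ?_⟩
  · have := h1.encard_eq_eRank
    rw [hk, Set.encard_coe_eq_coe_finsetCard, card_union_of_disjoint (by simp [ha, hb]),
      card_pair hab.ne] at this
    exact_mod_cast this
  · by_cases h5 : M.IsBase (S ∪ {a, c} : Finset (Fin n))
    · have h6 : ¬ M.IsBase (S ∪ {b, d} : Finset (Fin n)) := fun h => hnot' ⟨h5, h⟩
      rw [← squareVerts_rotate]
      refine square_isTwoFace hk hb hc hd ha hbc.ne hbd.ne hab.ne' hcd.ne hac.ne' had.ne'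
        h3 ?_ h4 ?_ h6
      · rwa [pair_comm]
      · rwa [pair_comm]
    · exact square_isTwoFace hk ha hb hc hd hab.ne hac.ne had.ne hbc.ne hbd.ne hcd.ne h1 h2 h3
        h4 h5

/-- A set with the extreme points of the square is not a positroid polytope. -/
theorem not_isPositroidPolytope_of_square {n : ℕ} {S : Finset (Fin n)} {a b c d : Fin n}
    (hab : a < b) (hbc : b < c) (hcd : c < d) (ha : a ∉ S) (hb : b ∉ S) (hc : c ∉ S) (hd : d ∉ S)
    {F : Set (Fin n → ℝ)} (hF : F.extremePoints ℝ = squareVerts S a b c d) :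
    ¬ IsPositroidPolytope F := by
  rintro ⟨N, hN, rfl⟩
  rw [matroidPolytope, extremePoints_convexHull_indVec, squareVerts_eq_image] at hF
  have hbases : ∀ B, N.IsBase B ↔ B ∈ ({(↑(S ∪ {a, b}) : Set (Fin n)), ↑(S ∪ {a, d}),
      ↑(S ∪ {b, c}), ↑(S ∪ {c, d})} : Set (Set (Fin n))) :=
    fun B => Set.ext_iff.mp (indVec_injective.image_injective hF) B
  have h := hN.posThreeTerm S a b c d hab hbc hcd ha hb hc hd
    (Or.inl ⟨(hbases _).mpr (by simp), (hbases _).mpr (by simp)⟩)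
  have h1 := (hbases _).mp h.1
  simp only [Set.mem_insert_iff, Set.mem_singleton_iff, coe_inj] at h1
  have hac := hab.trans hbc
  have hA : a ∈ S ∪ {a, c} := by simp
  have hC : c ∈ S ∪ {a, c} := by simp
  rcases h1 with h1 | h1 | h1 | h1 <;> rw [h1] at hA hC <;>
    simp [ha, hc, hab.ne, hac.ne, hac.ne', hbc.ne', hcd.ne, (hac.trans hcd).ne] at hA hC

end PositroidChar

/-! ### The characterization of positroid polytopes -/

open PositroidChar in
theorem theorem3p9 (n k : ℕ) (M : Matroid (Fin n)) (hE : M.E = Set.univ)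
    (hk : M.eRank = (k : ℕ∞)) :
    (IsPositroidPolytope (matroidPolytope M) ↔ IsPositroid M) ∧
    (IsPositroidPolytope (matroidPolytope M) ↔
      ∀ F : Set (Fin n → ℝ), IsTwoFace (matroidPolytope M) F → IsPositroidPolytope F) ∧
    (¬ IsPositroid M →
      ∃ (a b c d : Fin n) (S : Finset (Fin n)) (F : Set (Fin n → ℝ)),
        a < b ∧ b < c ∧ c < d ∧
        a ∉ S ∧ b ∉ S ∧ c ∉ S ∧ d ∉ S ∧
        S.card + 2 = k ∧
        IsTwoFace (matroidPolytope M) F ∧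
        F.extremePoints ℝ =
          {indVec (↑S ∪ {a, b}), indVec (↑S ∪ {a, d}),
            indVec (↑S ∪ {b, c}), indVec (↑S ∪ {c, d})}) := by
  have h1 : IsPositroidPolytope (matroidPolytope M) ↔ IsPositroid M := by
    constructor
    · rintro ⟨N, hN, h⟩
      rwa [matroid_eq_of_polytope_eq hE hN.1 h]
    · exact fun h => ⟨M, h, rfl⟩
  refine ⟨h1, ⟨fun h F hF => ?_, fun h => ?_⟩, fun h => ?_⟩
  · exact (h1.mp h).exposed hF.1 hF.2.1
  · rw [h1]
    refine isPositroid_of_posThreeTerm hE ?_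
    by_contra hM
    obtain ⟨a, b, c, d, S, hab, hbc, hcd, ha, hb, hc, hd, -, hF⟩ := exists_square_face hk hM
    exact not_isPositroidPolytope_of_square hab hbc hcd ha hb hc hd
      (extremePoints_square S a b c d) (h _ hF)
  · obtain ⟨a, b, c, d, S, hab, hbc, hcd, ha, hb, hc, hd, hS, hF⟩ := exists_square_face hk
      (fun hM => h (isPositroid_of_posThreeTerm hE hM))
    exact ⟨a, b, c, d, S, _, hab, hbc, hcd, ha, hb, hc, hd, hS, hF,
      extremePoints_square S a b c d⟩
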